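/- **Setting.** A rooted chord diagram of size $n$ is a fixed-point-free involution of $\{1,\dots,2n\}$, written $(x_1\,y_1)\cdots(x_n\,y_n)$ with $x_1<\dots<x_n$ and $x_r<y_r$; its chords are the transpositions and $(x_1\,y_1)$ is the root chord. Chords $r,r'$ cross if $x_r<x_{r'}<y_r<y_{r'}$ or $x_{r'}<x_r<y_{r'}<y_r$. The diagram is connected if its intersection graph (vertices: chords, edges: crossings) is connected, in particular $n\ge 1$. A chord $r$ is terminal if it crosses no chord $r'$ with $r'>r$. The chords of a connected diagram $C$ are labelled $1,\dots,|C|$ in the *intersection order*: first the root chord, then, one after the other in the order of their smallest endpoints, the connected components of $C$ without its root chord, each ordered recursively in the same way. The *base chord* is the terminal chord with the smallest label, and $b(C)$ is this label. *Insertion tree and $\nu$.* If $|C|=1$, then $T(C)$ is a single leaf carrying the chord. If $|C|>1$, let $C''$ be the first connected component (the one with the smallest endpoint) of $C$ without its root chord, let $C'=C\setminus C''$ (which is connected), and let $k$ be the number of endpoints of chords of $C''$ that precede the second endpoint of the root chord of $C$. Then $T(C)$ is the plane binary tree obtained from $T(C'')$ by numbering its edges in pre-order, beginning with a virtual edge above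 the root as number $1$, putting a new vertex on edge $k$, and giving it $T(C')$ as left subtree and the part of $T(C'')$ below edge $k$ as right subtree. The leaves of $T(C)$ correspond to the chords of $C$. For a chord $c$, $\nu_c$ is the number of edges of the path in $T(C)$ that starts in the leaf of $c$ and goes from right children to their parents as long as possible (so $\nu_c=0$ if the leaf is a left child or the root). *Decorations, weights, monomials.* Fix a set $\Delta$ of positive integers, a commutative binomial ring $R$ (for example $\mathbb Z$ or any commutative $\mathbb Q$-algebra), $s\in R$, and elements $a_{d,m}\in R$ for integers $d\ge 1$, $m\ge 0$. A decorated diagram is a rooted connected chord diagram $C$ with a decoration $d_c\in\Delta$ for each chord $c$; chords are identified with their labels. Let $\|C\|=\sum_c d_c$, $$\omega_C=\prod_{c}\binom{d_cs+\nu_c-2}{\nu_c},\qquad \omega_{\hat C}=\prod_{c\ne b(C)}\binom{d_cs+\nu_c-2}{\nu_c},$$ and, if the terminal chords have the labels $t_0<t_1<\dots<t_r$ (so $t_0=b(C)$), $$\hat a_C=\Bigl(\prod_{m=1}^{r}a_{d_{t_m},\,t_m-t_{m-1}}\Bigr)\prod_{c\text{ not terminal}}a_{d_c,0}.$$ **Proposition.**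 Let $i,j\ge 0$ be integers. All sums over $C$, $D_1$, $D_2$ below are (finite) sums over decorated diagrams. (1) If $j\ge 1$, then $$\sum_{\substack{\|C\|=i+1\\ b(C)=j+1}}\omega_{\hat C}\,\hat a_C=\sum_{k=1}^{i}\sum_{l=1}^{j}\binom{j}{l}\Bigl(\sum_{\substack{\|D_1\|=k\\ b(D_1)\ge l}}\omega_{D_1}\hat a_{D_1}\,a_{d_{b(D_1)},\,b(D_1)-l}\Bigr)\Bigl(\sum_{\substack{\|D_2\|=i-k+1\\ b(D_2)=j-l+1}}\omega_{\hat D_2}\hat a_{D_2}\Bigr).$$ (2) For every integer $n\ge 0$ with $j\ge 1$ or $n\ge 1$, $$\sum_{\substack{\|C\|=i+1\\ b(C)=j+1\\ \nu_{b(C)}=n}}\omega_{\hat C}\,\hat a_C=\sum_{k=1}^{i}\sum_{l=1}^{j}\binom{j}{l}\Bigl(\sum_{\substack{\|D_1\|=k\\ b(D_1)\ge l}}\omega_{D_1}\hat a_{D_1}\,a_{d_{b(D_1)},\,b(D_1)-l}\Bigr)\Bigl(\sum_{\substack{\|D_2\|=i-k+1\\ b(D_2)=j-l+1\\ \nu_{b(D_2)}=n-1}}\omega_{\hat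 D_2}\hat a_{D_2}\Bigr).$$ -/

import Mathlib

namespace ChordDiag

/-! ### Chords, crossings, connected components

Throughout, `D : α → α` sends an endpoint of a chord to the other endpoint, the points being
linearly ordered, and a chord `(x y)` with `x < y = D x` is represented by its smaller endpoint `x`.
A (sub)diagram is given by the finite set `S` of its chords. -/

section Subdiagrams

variable {α : Type*} [LinearOrder α]

/-- The chords `(x, D x)` and `(x', D x')` cross. -/
def Crosses (D : α → α) (x x' : α) : Prop :=
  (x < x' ∧ x' < D x ∧ D x < D x') ∨ (x' < x ∧ x < D x' ∧ D x' < D x)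

/-- The graph on the chords in which two chords are adjacent when they cross. -/
def crossingGraph (D : α → α) : SimpleGraph α where
  Adj := Crosses D
  symm := ⟨fun _ _ h => Or.symm h⟩
  loopless := ⟨fun x h => by rcases h with h | h <;> exact lt_irrefl x h.1⟩

/-- The intersection graph of the subdiagram with set of chords `S`. -/
def intersectionGraph (D : α → α) (S : Finset α) : SimpleGraph (S : Set α) :=
  (crossingGraph D).induce (S : Set α)

open Classical in
/-- The connected component of the chord `x` in the subdiagram `S`. -/
noncomputable def component (D : α → α) (S : Finset α) (x : α) : Finset α :=
  S.filter fun y => ∃ (hx : x ∈ (S : Set α)) (hy : y ∈ (S : Set α)),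
    (intersectionGraph D S).Reachable ⟨x, hx⟩ ⟨y, hy⟩

theorem component_subset (D : α → α) (S : Finset α) (x : α) : component D S x ⊆ S := by
  classical
  exact Finset.filter_subset _ _

theorem mem_component_self (D : α → α) {S : Finset α} {x : α} (hx : x ∈ S) :
    x ∈ component D S x := by
  classical
  exact Finset.mem_filter.mpr ⟨hx, hx, hx, SimpleGraph.Reachable.refl _⟩

/-- The chords of `S` listed in the intersection order: in each connected component, in
counterclockwise order of the components (that is, by their smallest point), first the root chord
of the component, and then recursively the rest of the component. -/
noncomputable def intersectionOrder (D : α → α) (S : Finset α) : List α :=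
  if h : S.Nonempty then
    S.min' h ::
      (intersectionOrder D ((component D S (S.min' h)).erase (S.min' h)) ++
        intersectionOrder D (S \ component D S (S.min' h)))
  else []
termination_by S.card
decreasing_by
  · exact lt_of_lt_of_le
      (Finset.card_erase_lt_of_mem (mem_component_self D (S.min'_mem h)))
      (Finset.card_le_card (component_subset D S _))
  · exact Finset.card_lt_card (Finset.sdiff_ssubset (component_subset D S _)
      ⟨_, mem_component_self D (S.min'_mem h)⟩)

/-- The label (starting from `1`) of the chord `x` in the intersection order of `S`. -/
noncomputable def label (D : α → α) (S : Finset α) (x : α) : ℕ :=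
  (intersectionOrder D S).idxOf x + 1

end Subdiagrams

/-! ### Insertion trees -/

/-- Rooted plane binary trees (each inner vertex has a left and a right child) with leaves labelled
by elements of `α`. -/
inductive PlaneTree (α : Type*) where
  | leaf (x : α) : PlaneTree α
  | node (l r : PlaneTree α) : PlaneTree α

namespace PlaneTree

variable {α : Type*}

/-- The number of vertices, which is the number of edges including the virtual edge above the
root. -/
def numEdges : PlaneTree α → ℕ
  | leaf _ => 1
  | node l r => 1 + l.numEdges + r.numEdges

/-- `T.insertAt k T'` is the tree `T ∘_k T'`. The edges of `T'` are numbered `1, …, numEdges T'` in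
pre-order, number `1` being the virtual edge above the root. A new vertex is put in the middle of
edge `k`; its left subtree is `T`, and its right subtree is the part of `T'` below the edge. (For
`k` out of range the value is irrelevant.) -/
def insertAt (T : PlaneTree α) (k : ℕ) : PlaneTree α → PlaneTree α
  | leaf x => node T (leaf x)
  | node l r =>
    if k ≤ 1 then node T (node l r)
    else if k - 1 ≤ l.numEdges then node (T.insertAt (k - 1) l) r
    else node l (T.insertAt (k - 1 - l.numEdges) r)

/-- `x` is the label of a leaf. -/
def HasLeaf (x : α) : PlaneTree α → Prop
  | leaf y => x = y
  | node l r => l.HasLeaf x ∨ r.HasLeaf x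

open Classical in
/-- Auxiliary to `nu`: the counter `n` is the number of consecutive edges to a right child that
end in the root of the current subtree. -/
noncomputable def nuAux (x : α) : ℕ → PlaneTree α → ℕ
  | n, leaf _ => n
  | n, node l r => if l.HasLeaf x then l.nuAux x 0 else r.nuAux x (n + 1)

/-- `T.nu x` is the number of edges of the path which starts in the leaf labelled `x` and moves up
and to the left (from a right child to its parent) as long as this is possible. -/
noncomputable def nu (T : PlaneTree α) (x : α) : ℕ := T.nuAux x 0

end PlaneTree

section Subdiagrams

variable {α : Type*} [LinearOrder α]

/-- `C₁`: the first connected component (in counterclockwise order) of the subdiagram `S` with its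
root chord removed, the empty set if there is none. -/
noncomputable def firstComponent (D : α → α) (S : Finset α) (h : S.Nonempty) : Finset α :=
  if h' : (S.erase (S.min' h)).Nonempty then
    component D (S.erase (S.min' h)) ((S.erase (S.min' h)).min' h')
  else ∅

theorem firstComponent_subset (D : α → α) (S : Finset α) (h : S.Nonempty) :
    firstComponent D S h ⊆ S.erase (S.min' h) := by
  unfold firstComponent
  split
  · exact component_subset _ _ _
  · exact Finset.empty_subset _

theorem min'_mem_sdiff_firstComponent (D : α → α) (S : Finset α) (h : S.Nonempty) :
    S.min' h ∈ S \ firstComponent D S h :=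
  Finset.mem_sdiff.mpr ⟨S.min'_mem h, fun hm =>
    Finset.notMem_erase _ _ (firstComponent_subset D S h hm)⟩

/-- The insertion place `k` of the root share decomposition `C = C' ∘_k C''`, where `C'' = C₁` is the
first connected component of `C` without its root chord, and `C' = C \ C₁`. In `C' ∘_k C''` the
points of `C'` other than its first one lie between the `k`-th and the `(k+1)`-st point of `C''`, and
one of them is the second endpoint of the root chord; so `k` is the number of endpoints of chords
of `C₁` that precede the second endpoint of the root chord. -/
noncomputable def insertionPlace (D : α → α) (S : Finset α) (h : S.Nonempty) : ℕ :=
  ((firstComponent D S h ∪ (firstComponent D S h).image D).filter (· < D (S.min' h))).card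

/-- The insertion tree of the connected subdiagram `S`: a single leaf if `S` consists of one chord,
and `T(C') ∘_k T(C'')` if `S = C' ∘_k C''` is the root share decomposition. Leaves are labelled by
the chords themselves. -/
noncomputable def insertionTree (D : α → α) (S : Finset α) (h : S.Nonempty) : PlaneTree α :=
  if hc : (firstComponent D S h).Nonempty then
    (insertionTree D (S \ firstComponent D S h)
      ⟨_, min'_mem_sdiff_firstComponent D S h⟩).insertAt
        (insertionPlace D S h)
        (insertionTree D (firstComponent D S h) hc)
  else PlaneTree.leaf (S.min' h)
termination_by S.card
decreasing_by
  · exact Finset.card_lt_card (Finset.sdiff_ssubset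
      ((firstComponent_subset D S h).trans (Finset.erase_subset _ _)) hc)
  · exact lt_of_le_of_lt (Finset.card_le_card (firstComponent_subset D S h))
      (Finset.card_erase_lt_of_mem (S.min'_mem h))

end Subdiagrams

/-! ### Rooted chord diagrams -/

/-- A rooted chord diagram of size `n`: a fixed point free involution of `2 n` points. -/
structure RootedChordDiagram (n : ℕ) where
  perm : Equiv.Perm (Fin (2 * n))
  sq_eq_one : perm ^ 2 = 1
  apply_ne : ∀ x, perm x ≠ x

namespace RootedChordDiagram

variable {n : ℕ}

/-- The chords, each represented by its smaller endpoint. -/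
def chords (C : RootedChordDiagram n) : Finset (Fin (2 * n)) :=
  Finset.univ.filter fun x => x < C.perm x

/-- `C` is connected: its intersection graph is connected (in particular it has a chord). -/
def IsConnected (C : RootedChordDiagram n) : Prop := (intersectionGraph C.perm C.chords).Connected

theorem perm_perm (C : RootedChordDiagram n) (x : Fin (2 * n)) : C.perm (C.perm x) = x := by
  have h := congrArg (fun f => f x) C.sq_eq_one
  simpa [pow_two] using h

theorem card_chords (C : RootedChordDiagram n) : C.chords.card = n := by
  have h1 : C.chords.card = (Finset.univ.filter fun x => ¬ x < C.perm x).card := by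
    refine Finset.card_nbij' C.perm C.perm ?_ ?_ ?_ ?_
    · intro x hx
      simp only [chords, Finset.coe_filter, Finset.mem_univ, true_and, Set.mem_ofPred_eq,
        perm_perm] at hx ⊢
      exact not_lt.mpr hx.le
    · intro x hx
      simp only [chords, Finset.coe_filter, Finset.mem_univ, true_and, Set.mem_ofPred_eq,
        perm_perm] at hx ⊢
      exact lt_of_le_of_ne (not_lt.mp hx) (C.apply_ne x)
    · intro x _
      exact C.perm_perm x
    · intro x _
      exact C.perm_perm x
  have h2 := Finset.card_filter_add_card_filter_not (s := (Finset.univ : Finset (Fin (2 * n))))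
    (fun x => x < C.perm x)
  rw [← h1] at h2
  simp only [Finset.card_univ, Fintype.card_fin] at h2
  have h3 : (Finset.univ.filter fun x => x < C.perm x).card = C.chords.card := rfl
  omega

instance : Finite (RootedChordDiagram n) :=
  Finite.of_injective (fun C : RootedChordDiagram n => C.perm) (by
    rintro ⟨p, _, _⟩ ⟨q, _, _⟩ h
    cases h
    rfl)

end RootedChordDiagram

/-! ### Decorated diagrams, weights and monomials -/

/-- Rooted connected chord diagrams with chords decorated by elements of the set `Δ` of positive
integers. -/
structure DecDiagram (Δ : Set ℕ+) where
  size : ℕ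
  diagram : RootedChordDiagram size
  connected : diagram.IsConnected
  dec : diagram.chords → Δ

namespace DecDiagram

variable {Δ : Set ℕ+} (C : DecDiagram Δ)

/-- The type of chords of `C`. -/
abbrev Chord : Type := C.diagram.chords

/-- The decoration of a chord. -/
def d (c : C.Chord) : ℕ+ := (C.dec c : ℕ+)

/-- `‖C‖`, the sum of the decorations. -/
def norm : ℕ := ∑ c : C.Chord, (C.d c : ℕ)

/-- The label of a chord in the intersection order. -/
noncomputable def lab (c : C.Chord) : ℕ := label C.diagram.perm C.diagram.chords c

theorem chords_nonempty : C.diagram.chords.Nonempty := by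
  obtain ⟨x⟩ := C.connected.nonempty
  exact ⟨x.1, x.2⟩

/-- The insertion tree `T(C)`. -/
noncomputable def tree : PlaneTree (Fin (2 * C.size)) :=
  insertionTree C.diagram.perm C.diagram.chords C.chords_nonempty

/-- The component of the branch-left vector that belongs to the chord `c`. -/
noncomputable def nu (c : C.Chord) : ℕ := C.tree.nu (c : Fin (2 * C.size))

open Classical in
/-- The terminal chords: those which cross no chord with larger first endpoint. -/
noncomputable def ter : Finset C.Chord :=
  Finset.univ.filter fun c => ∀ e : C.Chord, c < e → ¬ Crosses C.diagram.perm (c : Fin _) e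

theorem ter_nonempty : C.ter.Nonempty := by
  have h := C.chords_nonempty
  refine ⟨⟨_, C.diagram.chords.max'_mem h⟩, ?_⟩
  simp only [ter, Finset.mem_filter, Finset.mem_univ, true_and]
  intro e he
  exact absurd (C.diagram.chords.le_max' e.1 e.2) (not_le.mpr he)

/-- The base chord: the terminal chord whose label in the intersection order is smallest. -/
noncomputable def baseChord : C.Chord :=
  (Finset.exists_min_image C.ter C.lab C.ter_nonempty).choose

/-- `b(C)`, the label of the base chord. -/
noncomputable def b : ℕ := C.lab C.baseChord

open Classical in
/-- The label of the terminal chord preceding the terminal chord `c` in the intersection order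
(for `c` not the base chord). -/
noncomputable def prevTerLab (c : C.Chord) : ℕ :=
  (C.ter.filter fun e => C.lab e < C.lab c).sup C.lab

section Coefficients

variable {R : Type*} [CommRing R]

open Classical in
/-- The monomial `â_C`, the product of `a_{d_{t_m}, t_m - t_{m-1}}` over the terminal chords
`t_0 < t_1 < ⋯` other than the base chord `t_0`, and of `a_{d_c, 0}` over the chords `c` that
are not terminal. -/
noncomputable def aHat (a : ℕ+ → ℕ → R) : R :=
  (∏ c ∈ C.ter.erase C.baseChord, a (C.d c) (C.lab c - C.prevTerLab c)) *
    ∏ c ∈ C.terᶜ, a (C.d c) 0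

variable [BinomialRing R]

/-- The factor `binom(d_c s + ν_c - 2, ν_c)` of the weight. -/
noncomputable def weightFactor (s : R) (c : C.Chord) : R :=
  Ring.choose (((C.d c : ℕ) : R) * s + (C.nu c : R) - 2) (C.nu c)

/-- The weight `ω_C`. -/
noncomputable def weight (s : R) : R := ∏ c : C.Chord, C.weightFactor s c

open Classical in
/-- The weight `ω_Ĉ`, without the factor of the base chord. -/
noncomputable def weightHat (s : R) : R :=
  ∏ c ∈ Finset.univ.erase C.baseChord, C.weightFactor s c

end Coefficients

theorem size_le_norm : C.size ≤ C.norm := by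
  have h : ∑ _c : C.Chord, 1 ≤ C.norm := Finset.sum_le_sum fun c _ => (C.d c).2
  simpa [RootedChordDiagram.card_chords] using h

variable (Δ) in
theorem finite_norm_eq (m : ℕ) : {C : DecDiagram Δ | C.norm = m}.Finite := by
  have key : ∀ C : {C : DecDiagram Δ | C.norm = m}, ∀ c : C.1.Chord, (C.1.d c : ℕ) < m + 1 := by
    rintro ⟨C, hC⟩ c
    have h : (C.d c : ℕ) ≤ C.norm :=
      Finset.single_le_sum (f := fun c : C.Chord => (C.d c : ℕ)) (fun _ _ => Nat.zero_le _)
        (Finset.mem_univ c)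
    have hm : C.norm = m := hC
    show (C.d c : ℕ) < m + 1
    omega
  let F : {C : DecDiagram Δ | C.norm = m} →
      Σ n : Fin (m + 1), Σ D : RootedChordDiagram (n : ℕ), (D.chords → Fin (m + 1)) := fun C =>
    ⟨⟨C.1.size, Nat.lt_succ_of_le (C.1.size_le_norm.trans_eq C.2)⟩, C.1.diagram,
      fun c => ⟨C.1.d c, key C c⟩⟩
  have hF : Function.Injective F := by
    rintro ⟨⟨n, D, hD, f⟩, hC⟩ ⟨⟨n', D', hD', f'⟩, hC'⟩ h
    simp only [F, Sigma.mk.injEq, Fin.mk.injEq] at h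
    obtain ⟨rfl, h⟩ := h
    simp only [heq_eq_eq, Sigma.mk.injEq] at h
    obtain ⟨rfl, h⟩ := h
    have hf : f = f' := by
      funext c
      have h1 := congrArg Fin.val (congrFun (eq_of_heq h) c)
      exact Subtype.ext (PNat.coe_injective h1)
    subst hf
    rfl
  exact Set.finite_coe_iff.mp (Finite.of_injective F hF)

variable (Δ) in
/-- The finite set of decorated diagrams `C` with `‖C‖ = m`. -/
noncomputable def ofNorm (m : ℕ) : Finset (DecDiagram Δ) := (finite_norm_eq Δ m).toFinset

theorem mem_ofNorm (m : ℕ) : C ∈ ofNorm Δ m ↔ C.norm = m := by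
  simp [ofNorm]

end DecDiagram

end ChordDiag

/-! Everything rests on the root share decomposition `C = C' ∘_k C''`. It is a bijection between
diagrams with at least two chords and triples `(C', C'', k)` with `1 ≤ k ≤ 2|C''| - 1`
(`exists_decomp`, `exists_comp`, `Decomp.eq_of_parts`, `Decomp.parts_eq`), and all data of the
statement split along it. The norm is additive. The intersection order lists the root, then `C''`,
then the rest of `C'`; the root is not terminal in `C`, and the base chord of `C` is that of `C''`.
Hence `b(C) = b(C'') + 1`, and `â_C` is the product of `â_{C''}`, `â_{C'}` and the new factor `a_{d,
b(C')-1}` of the base chord of `C'` (`Decomp.aHat_eq`). In the insertion tree, `ν` is unchanged on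
`C'`, and on `C''` it grows by one at a single chord, the owner of edge `k`.

A chord `c` owns exactly `ν_c + 1` edges (`PlaneTree.card_owner`), and `(ν+1) binom(ds+ν-1, ν+1) =
(ds+ν-1) binom(ds+ν-2, ν)` (`factor_succ`). Summing over `k` therefore multiplies `ω_{C''}` by `∑
(d_c s + ν_c - 1) = s‖C''‖ - 1`. Let `L = s X d/dX`, let `A_l` be the generating function by norm of
the left summands, and `F_{j,n}` that of `ω_Ĉ â_C` with `b = j`, `ν_b = n` and a fixed decoration
`d` of the base chord. For `l, j ≥ 1`, `A_{l+1} = A_1 (L A_l - A_l)`, `F_{j+1,n} = A_1 (L F_{j,n} -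
d s F_{j,n} - n F_{j,n} + n F_{j,n-1})`. Diagrams with `b = 1` are single chords, so `L F_{1,0} = d
s F_{1,0}` and `F_{1,n} = 0` for `n > 0`.

As `L` is a derivation, induction on `j` and Pascal's rule give `F_{j+2,0} = 0` and `F_{j+1,n+1} = ∑
binom(j,l) A_l F_{j-l+1,n}`, the sum over `1 ≤ l ≤ j` (`leibniz_recursion`). Coefficients, summed
over `d`, give (2); summing over `n` as well gives (1). -/

namespace ChordDiag

/-! ### Connectedness, components and intersection order of subdiagrams -/

section Generic

variable {α : Type*} [LinearOrder α]

/-- The chords `u`, `v` of `S` cross. -/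
def CrossIn (D : α → α) (S : Finset α) (u v : α) : Prop := u ∈ S ∧ v ∈ S ∧ Crosses D u v

theorem Crosses.symm {D : α → α} {u v : α} (h : Crosses D u v) : Crosses D v u := Or.symm h

theorem CrossIn.symm {D : α → α} {S : Finset α} {u v : α} (h : CrossIn D S u v) :
    CrossIn D S v u := ⟨h.2.1, h.1, h.2.2.symm⟩

theorem CrossIn.mono {D : α → α} {S T : Finset α} (hST : S ⊆ T) {u v : α} (h : CrossIn D S u v) :
    CrossIn D T u v := ⟨hST h.1, hST h.2.1, h.2.2⟩

theorem reflTransGen_crossIn_symm {D : α → α} {S : Finset α} {u v : α}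
    (h : Relation.ReflTransGen (CrossIn D S) u v) : Relation.ReflTransGen (CrossIn D S) v u := by
  induction h with
  | refl => exact .refl
  | tail _ h ih => exact .head h.symm ih

theorem reflTransGen_crossIn_mem {D : α → α} {S : Finset α} {u v : α}
    (h : Relation.ReflTransGen (CrossIn D S) u v) (hu : u ∈ S) : v ∈ S := by
  induction h with
  | refl => exact hu
  | tail _ h _ => exact h.2.1

/-- Replacing the graph on a subtype by a relation on `α` lets `S` be enlarged, mapped or split
without transporting vertices. -/
theorem reachable_iff {D : α → α} {S : Finset α} {x y : α} (hx : x ∈ (S : Set α))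
    (hy : y ∈ (S : Set α)) :
    (intersectionGraph D S).Reachable ⟨x, hx⟩ ⟨y, hy⟩ ↔
      Relation.ReflTransGen (CrossIn D S) x y := by
  rw [SimpleGraph.reachable_iff_reflTransGen]
  constructor
  · intro h
    exact Relation.ReflTransGen.lift (r := (intersectionGraph D S).Adj) (p := CrossIn D S)
      (fun z => (z : α)) (fun u v h => ⟨u.2, v.2, h⟩) _ _ h
  · intro h
    induction h with
    | refl => exact .refl
    | tail _ h ih => exact .tail (ih h.1) h.2.2

theorem mem_component_iff {D : α → α} {S : Finset α} {x y : α} :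
    y ∈ component D S x ↔ x ∈ S ∧ Relation.ReflTransGen (CrossIn D S) x y := by
  classical
  unfold component
  rw [Finset.mem_filter]
  constructor
  · rintro ⟨_, hx, hy, h⟩
    exact ⟨hx, (reachable_iff hx hy).1 h⟩
  · rintro ⟨hx, h⟩
    have hy := reflTransGen_crossIn_mem h hx
    exact ⟨hy, hx, hy, (reachable_iff (S := S) hx hy).2 h⟩

/-- The subdiagram `S` is connected. -/
def Conn (D : α → α) (S : Finset α) : Prop :=
  S.Nonempty ∧ ∀ x ∈ S, ∀ y ∈ S, Relation.ReflTransGen (CrossIn D S) x y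

theorem connected_iff {D : α → α} {S : Finset α} :
    (intersectionGraph D S).Connected ↔ Conn D S := by
  constructor
  · intro h
    obtain ⟨z⟩ := h.nonempty
    exact ⟨⟨z.1, z.2⟩, fun x hx y hy =>
      (reachable_iff (S := S) hx hy).1 (h.preconnected ⟨x, hx⟩ ⟨y, hy⟩)⟩
  · rintro ⟨⟨z, hz⟩, h⟩
    have : Nonempty (S : Set α) := ⟨⟨z, hz⟩⟩
    exact ⟨fun x y => (reachable_iff x.2 y.2).2 (h x.1 x.2 y.1 y.2)⟩

theorem Conn.induction {D : α → α} {S : Finset α} (h : Conn D S) {p : α → Prop} {x : α}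
    (hx : x ∈ S) (hp : p x) (step : ∀ u ∈ S, ∀ v ∈ S, p u → Crosses D u v → p v) :
    ∀ y ∈ S, p y := by
  intro y hy
  have := h.2 x hx y hy
  clear hy
  induction this with
  | refl => exact hp
  | tail _ h ih => exact step _ h.1 _ h.2.1 ih h.2.2

theorem Conn.of_root {D : α → α} {S : Finset α} {x : α} (hx : x ∈ S)
    (h : ∀ y ∈ S, Relation.ReflTransGen (CrossIn D S) x y) : Conn D S :=
  ⟨⟨x, hx⟩, fun u hu v hv => (reflTransGen_crossIn_symm (h u hu)).trans (h v hv)⟩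

theorem conn_component {D : α → α} {S : Finset α} {x : α} (hx : x ∈ S) :
    Conn D (component D S x) := by
  refine Conn.of_root (mem_component_self D hx) fun y hy => ?_
  have h := (mem_component_iff.1 hy).2
  clear hy
  induction h with
  | refl => exact .refl
  | tail h1 h ih =>
    exact ih.tail ⟨mem_component_iff.2 ⟨hx, h1⟩, mem_component_iff.2 ⟨hx, h1.tail h⟩, h.2.2⟩

theorem component_closed {D : α → α} {S : Finset α} {x u v : α} (hu : u ∈ component D S x)
    (hv : v ∈ S) (h : Crosses D u v) : v ∈ component D S x :=
  mem_component_iff.2 ⟨(mem_component_iff.1 hu).1,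
    (mem_component_iff.1 hu).2.tail ⟨component_subset _ _ _ hu, hv, h⟩⟩

/-- A walk in `S` cannot leave a set closed under crossings, and connectedness of `T` makes all of
it reachable. -/
theorem component_eq {D : α → α} {S T : Finset α} {x : α} (hT : Conn D T) (hTS : T ⊆ S)
    (hx : x ∈ T) (hcl : ∀ u ∈ T, ∀ v ∈ S, Crosses D u v → v ∈ T) : component D S x = T := by
  ext y
  rw [mem_component_iff]
  constructor
  · rintro ⟨_, h⟩
    induction h with
    | refl => exact hx
    | tail _ h ih => exact hcl _ ih _ h.2.1 h.2.2
  · intro hy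
    exact ⟨hTS hx, Relation.ReflTransGen.mono (fun _ _ h => h.mono hTS) _ _ (hT.2 x hx y hy)⟩

theorem intersectionOrder_empty (D : α → α) : intersectionOrder D (∅ : Finset α) = [] := by
  rw [intersectionOrder]; simp

theorem intersectionOrder_of_nonempty (D : α → α) {S : Finset α} (h : S.Nonempty) :
    intersectionOrder D S = S.min' h ::
      (intersectionOrder D ((component D S (S.min' h)).erase (S.min' h)) ++
        intersectionOrder D (S \ component D S (S.min' h))) := by
  rw [intersectionOrder, dif_pos h]

theorem intersectionOrder_perm (D : α → α) (S : Finset α) :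
    (intersectionOrder D S).Perm S.toList := by
  induction S using Finset.strongInduction with
  | H S ih =>
    rcases S.eq_empty_or_nonempty with rfl | h
    · simp [intersectionOrder_empty]
    · rw [intersectionOrder_of_nonempty D h]
      have hm := mem_component_self D (S.min'_mem h)
      have h1 : (component D S (S.min' h)).erase (S.min' h) ⊂ S :=
        (Finset.erase_ssubset hm).trans_subset (component_subset _ _ _)
      have h2 : S \ component D S (S.min' h) ⊂ S :=
        Finset.sdiff_ssubset (component_subset D S _) ⟨_, hm⟩
      refine (((ih _ h1).append (ih _ h2)).cons _).trans ?_
      rw [← Multiset.coe_eq_coe]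
      rw [← Multiset.cons_coe, ← Multiset.coe_add, Finset.coe_toList, Finset.coe_toList,
        Finset.coe_toList, ← Multiset.cons_add, Finset.erase_val,
        Multiset.cons_erase hm, Finset.sdiff_val]
      exact add_tsub_cancel_of_le (Finset.val_le_iff.2 (component_subset D S _))

theorem mem_intersectionOrder {D : α → α} {S : Finset α} {x : α} :
    x ∈ intersectionOrder D S ↔ x ∈ S := by
  rw [(intersectionOrder_perm D S).mem_iff, Finset.mem_toList]

theorem length_intersectionOrder (D : α → α) (S : Finset α) :
    (intersectionOrder D S).length = S.card := by
  rw [(intersectionOrder_perm D S).length_eq, Finset.length_toList]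

theorem Conn.intersectionOrder_eq {D : α → α} {S : Finset α} (hS : Conn D S) (h : S.Nonempty) :
    intersectionOrder D S = S.min' h :: intersectionOrder D (S.erase (S.min' h)) := by
  rw [intersectionOrder_of_nonempty D h,
    component_eq hS subset_rfl (S.min'_mem h) (fun _ _ _ hv _ => hv)]
  simp [intersectionOrder_empty]

theorem firstComponent_nonempty {D : α → α} {S : Finset α} (h : S.Nonempty)
    (h' : (S.erase (S.min' h)).Nonempty) : (firstComponent D S h).Nonempty := by
  rw [firstComponent, dif_pos h']
  exact ⟨_, mem_component_self D (Finset.min'_mem _ h')⟩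

/-- One unfolding at the smallest remaining chord peels off the first component; what is left are
the non-root chords of `C'`. This adapts the recursion by components to the root share
decomposition. -/
theorem intersectionOrder_erase_min {D : α → α} {S : Finset α} (h : S.Nonempty) :
    intersectionOrder D (S.erase (S.min' h)) =
      intersectionOrder D (firstComponent D S h) ++
        intersectionOrder D ((S \ firstComponent D S h).erase (S.min' h)) := by
  unfold firstComponent
  split
  · next h' =>
    have hc := conn_component (D := D) (Finset.min'_mem _ h')
    have hmem := mem_component_self D (Finset.min'_mem _ h')
    have hmin : (component D (S.erase (S.min' h)) ((S.erase (S.min' h)).min' h')).min' ⟨_, hmem⟩ =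
        (S.erase (S.min' h)).min' h' :=
      le_antisymm (Finset.min'_le _ _ hmem)
        (Finset.min'_le _ _ (component_subset _ _ _ (Finset.min'_mem _ _)))
    rw [intersectionOrder_of_nonempty D h', hc.intersectionOrder_eq ⟨_, hmem⟩, hmin,
      List.cons_append, Finset.erase_sdiff_comm]
  · next h' =>
    rw [Finset.not_nonempty_iff_eq_empty] at h'
    simp [h', intersectionOrder_empty]

end Generic

/-! ### Invariance under order embeddings compatible with the involutions -/

section Transport

variable {α β : Type*} [LinearOrder α] [LinearOrder β] {D : α → α} {E : β → β} {e : β ↪o α}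

theorem crosses_map (he : ∀ x, e (E x) = D (e x)) {x y : β} :
    Crosses D (e x) (e y) ↔ Crosses E x y := by
  simp only [Crosses, ← he, e.lt_iff_lt]

theorem crossIn_map (he : ∀ x, e (E x) = D (e x)) {S : Finset β} {x y : β} :
    CrossIn D (S.map e.toEmbedding) (e x) (e y) ↔ CrossIn E S x y := by
  have h : ∀ z, e z ∈ S.map e.toEmbedding ↔ z ∈ S := fun z => Finset.mem_map' e.toEmbedding
  simp only [CrossIn, crosses_map he, h]

theorem reflTransGen_map (he : ∀ x, e (E x) = D (e x)) {S : Finset β} {x y : β} :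
    Relation.ReflTransGen (CrossIn D (S.map e.toEmbedding)) (e x) (e y) ↔
      Relation.ReflTransGen (CrossIn E S) x y := by
  constructor
  · intro h
    suffices H : ∀ z, Relation.ReflTransGen (CrossIn D (S.map e.toEmbedding)) (e x) z →
        ∃ y, z = e y ∧ Relation.ReflTransGen (CrossIn E S) x y by
      obtain ⟨y', h1, h2⟩ := H _ h
      rwa [e.injective h1]
    intro z hz
    induction hz with
    | refl => exact ⟨x, rfl, .refl⟩
    | tail _ h ih =>
      obtain ⟨u, rfl, hu⟩ := ih
      obtain ⟨v, hv, rfl⟩ := Finset.mem_map.1 h.2.1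
      exact ⟨v, rfl, hu.tail ((crossIn_map he).1 h)⟩
  · exact Relation.ReflTransGen.lift (p := CrossIn D (S.map e.toEmbedding)) e
      (fun u v h => (crossIn_map he).2 h) x y

theorem conn_map (he : ∀ x, e (E x) = D (e x)) {S : Finset β} :
    Conn D (S.map e.toEmbedding) ↔ Conn E S := by
  simp only [Conn, Finset.map_nonempty, Finset.forall_mem_map]
  exact and_congr_right fun _ => forall₄_congr fun x _ y _ => reflTransGen_map he

theorem component_map (he : ∀ x, e (E x) = D (e x)) (S : Finset β) (x : β) :
    component D (S.map e.toEmbedding) (e x) = (component E S x).map e.toEmbedding := by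
  ext z
  have h : ∀ z, e z ∈ S.map e.toEmbedding ↔ z ∈ S := fun z => Finset.mem_map' e.toEmbedding
  rw [Finset.mem_map]
  constructor
  · intro hz
    obtain ⟨y, _, rfl⟩ := Finset.mem_map.1 (component_subset _ _ _ hz)
    rw [mem_component_iff] at hz
    exact ⟨y, mem_component_iff.2 ⟨(h x).1 hz.1, (reflTransGen_map he).1 hz.2⟩, rfl⟩
  · rintro ⟨y, hy, rfl⟩
    rw [mem_component_iff] at hy
    exact mem_component_iff.2 ⟨(h x).2 hy.1, (reflTransGen_map he).2 hy.2⟩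

theorem min'_map (S : Finset β) (h : (S.map e.toEmbedding).Nonempty) :
    (S.map e.toEmbedding).min' h = e (S.min' (Finset.map_nonempty.1 h)) := by
  refine le_antisymm (Finset.min'_le _ _ (Finset.mem_map_of_mem _ (Finset.min'_mem _ _))) ?_
  refine Finset.le_min' _ _ _ fun y hy => ?_
  obtain ⟨x, hx, rfl⟩ := Finset.mem_map.1 hy
  exact e.le_iff_le.2 (Finset.min'_le _ _ hx)

theorem erase_map (S : Finset β) (x : β) :
    (S.map e.toEmbedding).erase (e x) = (S.erase x).map e.toEmbedding :=
  (Finset.map_erase e.toEmbedding S x).symm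

theorem sdiff_map (S T : Finset β) :
    S.map e.toEmbedding \ T.map e.toEmbedding = (S \ T).map e.toEmbedding := by
  ext z; simp only [Finset.mem_sdiff, Finset.mem_map]
  constructor
  · rintro ⟨⟨x, hx, rfl⟩, h⟩
    exact ⟨x, ⟨hx, fun hT => h ⟨x, hT, rfl⟩⟩, rfl⟩
  · rintro ⟨x, ⟨hx, hT⟩, rfl⟩
    exact ⟨⟨x, hx, rfl⟩, fun ⟨y, hy, h⟩ => hT (e.injective h ▸ hy)⟩

/-- Minima and components are defined from the order and the matching alone, and `e` preserves both.
-/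
theorem intersectionOrder_map (he : ∀ x, e (E x) = D (e x)) (S : Finset β) :
    intersectionOrder D (S.map e.toEmbedding) = (intersectionOrder E S).map e := by
  induction S using Finset.strongInduction with
  | H S ih =>
    rcases S.eq_empty_or_nonempty with rfl | h
    · simp [intersectionOrder_empty]
    · have hm := mem_component_self E (S.min'_mem h)
      have h1 : (component E S (S.min' h)).erase (S.min' h) ⊂ S :=
        (Finset.erase_ssubset hm).trans_subset (component_subset _ _ _)
      have h2 : S \ component E S (S.min' h) ⊂ S :=
        Finset.sdiff_ssubset (component_subset E S _) ⟨_, hm⟩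
      rw [intersectionOrder_of_nonempty E h,
        intersectionOrder_of_nonempty D (Finset.map_nonempty.2 h), min'_map,
        component_map he, erase_map, sdiff_map, ih _ h1, ih _ h2, List.map_cons, List.map_append]

theorem firstComponent_map (he : ∀ x, e (E x) = D (e x)) (S : Finset β)
    (h : (S.map e.toEmbedding).Nonempty) :
    firstComponent D (S.map e.toEmbedding) h =
      (firstComponent E S (Finset.map_nonempty.1 h)).map e.toEmbedding := by
  simp only [firstComponent, min'_map, erase_map, Finset.map_nonempty]
  split
  · rw [component_map he]
  · rfl

theorem insertionPlace_map (he : ∀ x, e (E x) = D (e x)) (S : Finset β)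
    (h : (S.map e.toEmbedding).Nonempty) :
    insertionPlace D (S.map e.toEmbedding) h = insertionPlace E S (Finset.map_nonempty.1 h) := by
  rw [insertionPlace, insertionPlace, firstComponent_map he, min'_map, ← he]
  generalize firstComponent E S (Finset.map_nonempty.1 h) = T
  have : (T.map e.toEmbedding).image D = (T.image E).map e.toEmbedding := by
    ext z
    simp [← he]
  rw [this, ← Finset.map_union, Finset.filter_map, Finset.card_map]
  congr 2
  ext x
  exact e.lt_iff_lt

/-- Relabelling of the leaves. -/
def PlaneTree.map {α β : Type*} (f : α → β) : PlaneTree α → PlaneTree β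
  | leaf x => leaf (f x)
  | node l r => node (l.map f) (r.map f)

theorem PlaneTree.numEdges_map {α β : Type*} (f : α → β) (T : PlaneTree α) :
    (T.map f).numEdges = T.numEdges := by
  induction T with
  | leaf => rfl
  | node l r hl hr => simp [PlaneTree.map, numEdges, hl, hr]

theorem PlaneTree.insertAt_map {α β : Type*} (f : α → β) (T T' : PlaneTree α) (k : ℕ) :
    (T.insertAt k T').map f = (T.map f).insertAt k (T'.map f) := by
  induction T' generalizing k with
  | leaf => rfl
  | node l r hl hr =>
    simp only [insertAt, PlaneTree.map, numEdges_map]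
    split_ifs <;> simp [PlaneTree.map, hl, hr]

/-- The parts enter through equations because the tree depends on nonemptiness proofs, which would
obstruct rewriting the sets in place. -/
theorem insertionTree_eq_insertAt (D : α → α) {S T' T'' : Finset α} (h : S.Nonempty)
    (h'' : firstComponent D S h = T'') (h' : S \ T'' = T') (n'' : T''.Nonempty)
    (n' : T'.Nonempty) :
    insertionTree D S h = (insertionTree D T' n').insertAt (insertionPlace D S h)
      (insertionTree D T'' n'') := by
  subst h'' h'
  rw [insertionTree, dif_pos n'']

theorem insertionTree_of_not_nonempty (D : α → α) (S : Finset α) (h : S.Nonempty)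
    (hc : ¬ (firstComponent D S h).Nonempty) :
    insertionTree D S h = PlaneTree.leaf (S.min' h) := by
  rw [insertionTree, dif_neg hc]

theorem insertionTree_map (he : ∀ x, e (E x) = D (e x)) (S : Finset β)
    (h : (S.map e.toEmbedding).Nonempty) :
    insertionTree D (S.map e.toEmbedding) h =
      (insertionTree E S (Finset.map_nonempty.1 h)).map e := by
  induction S using Finset.strongInduction with
  | H S ih =>
    have hS := Finset.map_nonempty.1 h
    have hfc := firstComponent_map he S h
    by_cases hc : (firstComponent E S hS).Nonempty
    · have h1 : S \ firstComponent E S hS ⊂ S := Finset.sdiff_ssubset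
        ((firstComponent_subset E S hS).trans (Finset.erase_subset _ _)) hc
      have h2 : firstComponent E S hS ⊂ S :=
        (firstComponent_subset E S hS).trans_ssubset (Finset.erase_ssubset (S.min'_mem hS))
      have h3 : (S \ firstComponent E S hS).Nonempty := ⟨_, min'_mem_sdiff_firstComponent E S hS⟩
      rw [insertionTree_eq_insertAt E hS rfl rfl hc h3,
        insertionTree_eq_insertAt D h hfc (sdiff_map _ _) (Finset.map_nonempty.2 hc)
          (Finset.map_nonempty.2 h3),
        PlaneTree.insertAt_map, insertionPlace_map he, ih _ h1, ih _ h2]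
    · have hc' : ¬ (firstComponent D (S.map e.toEmbedding) h).Nonempty := by
        rw [hfc, Finset.map_nonempty]; exact hc
      rw [insertionTree_of_not_nonempty D _ h hc', insertionTree_of_not_nonempty E _ hS hc,
        min'_map]
      rfl

end Transport

/-! ### Leaves, edges and `ν` in plane binary trees -/

namespace PlaneTree

variable {α β : Type*}

/-- The leaves from left to right. -/
def leaves : PlaneTree α → List α
  | leaf x => [x]
  | node l r => l.leaves ++ r.leaves

theorem hasLeaf_iff {T : PlaneTree α} {x : α} : T.HasLeaf x ↔ x ∈ T.leaves := by
  induction T with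
  | leaf => simp [HasLeaf, leaves]
  | node l r hl hr => simp [HasLeaf, leaves, hl, hr]

theorem leaves_map (f : α → β) (T : PlaneTree α) : (T.map f).leaves = T.leaves.map f := by
  induction T with
  | leaf => rfl
  | node l r hl hr => simp [PlaneTree.map, leaves, hl, hr]

/-- With the virtual edge, `n` leaves give `2n - 1` edges, as many as there are insertion places in
a diagram of size `n`. -/
theorem numEdges_add_one (T : PlaneTree α) : T.numEdges + 1 = 2 * T.leaves.length := by
  induction T with
  | leaf => rfl
  | node l r hl hr => simp only [numEdges, leaves, List.length_append]; omega

theorem leaves_insertAt_perm (T T' : PlaneTree α) (k : ℕ) :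
    (T.insertAt k T').leaves.Perm (T.leaves ++ T'.leaves) := by
  induction T' generalizing k with
  | leaf => simp [insertAt, leaves]
  | node l r hl hr =>
    simp only [insertAt]
    split_ifs
    · simp [leaves]
    · simpa [leaves] using (hl (k - 1)).append_right r.leaves
    · simp only [leaves]
      refine ((hr _).append_left l.leaves).trans ?_
      rw [← List.append_assoc, ← List.append_assoc]
      exact List.perm_append_comm.append_right _

/-- The last leaf. -/
def rightmost : PlaneTree α → α
  | leaf x => x
  | node _ r => r.rightmost

theorem rightmost_mem (T : PlaneTree α) : T.rightmost ∈ T.leaves := by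
  induction T with
  | leaf => simp [rightmost, leaves]
  | node l r hl hr => simp [rightmost, leaves, hr]

/-- The leaf in which the path ends that starts with the `k`-th edge and continues to right
children. -/
def owner : ℕ → PlaneTree α → α
  | _, leaf x => x
  | k, node l r =>
    if k ≤ 1 then r.rightmost
    else if k - 1 ≤ l.numEdges then l.owner (k - 1) else r.owner (k - 1 - l.numEdges)

theorem owner_mem (T : PlaneTree α) (k : ℕ) : T.owner k ∈ T.leaves := by
  induction T generalizing k with
  | leaf => simp [owner, leaves]
  | node l r hl hr =>
    simp only [owner, leaves, List.mem_append]
    split_ifs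
    · exact .inr r.rightmost_mem
    · exact .inl (hl _)
    · exact .inr (hr _)

open Classical in
-- The counter is reset at the first step to the left, so its initial value matters only for the
-- rightmost leaf.
theorem nuAux_succ {T : PlaneTree α} (hT : T.leaves.Nodup) {x : α} (hx : x ∈ T.leaves) (n : ℕ) :
    T.nuAux x (n + 1) = T.nuAux x n + if T.rightmost = x then 1 else 0 := by
  induction T generalizing n with
  | leaf y =>
    obtain rfl : x = y := by simpa [leaves] using hx
    simp [nuAux, rightmost]
  | node l r hl hr =>
    simp only [leaves, List.nodup_append] at hT
    simp only [nuAux, hasLeaf_iff, rightmost]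
    split_ifs with h1 h2 h2
    · exact absurd h2.symm (hT.2.2 x h1 _ r.rightmost_mem)
    · simp [h2]
    all_goals
      have hx : x ∈ r.leaves := by simpa [leaves, h1] using hx
      simpa [h2] using hr hT.2.1 hx (n + 1)

open Classical in
-- Subdividing edge `k` creates one new right edge, directly above the old subtree, while the upper
-- half of the edge keeps its direction. Only the rightmost leaf of that subtree, the owner of the
-- edge, has a path through it.
theorem nuAux_insertAt_right {T T' : PlaneTree α} (hT' : T'.leaves.Nodup) {x : α}
    (hx : x ∈ T'.leaves) (hxT : x ∉ T.leaves) (k n : ℕ) :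
    (T.insertAt k T').nuAux x n = T'.nuAux x n + if T'.owner k = x then 1 else 0 := by
  induction T' generalizing k n with
  | leaf y =>
    obtain rfl : x = y := by simpa [leaves] using hx
    simp [insertAt, nuAux, hasLeaf_iff, hxT, owner]
  | node l r hl hr =>
    have hT := hT'
    simp only [leaves, List.nodup_append] at hT
    simp only [insertAt, owner]
    split_ifs with h1 h2 h3 h4 h5
    · simpa [nuAux, hasLeaf_iff, hxT] using
        (nuAux_succ hT' hx n).trans (by simp [rightmost, h2, nuAux, hasLeaf_iff])
    · simpa [nuAux, hasLeaf_iff, hxT] using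
        (nuAux_succ hT' hx n).trans (by simp [rightmost, h2, nuAux, hasLeaf_iff])
    · have hxl : x ∈ l.leaves := h4 ▸ l.owner_mem _
      simpa [nuAux, hasLeaf_iff, (leaves_insertAt_perm T l (k - 1)).mem_iff, hxl, h4] using
        hl hT.1 hxl (k - 1) 0
    · by_cases hxl : x ∈ l.leaves
      · simpa [nuAux, hasLeaf_iff, (leaves_insertAt_perm T l (k - 1)).mem_iff, hxl, h4] using
          hl hT.1 hxl (k - 1) 0
      · simp [nuAux, hasLeaf_iff, (leaves_insertAt_perm T l (k - 1)).mem_iff, hxl, hxT]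
    · have hxr : x ∈ r.leaves := h5 ▸ r.owner_mem _
      have hxl : x ∉ l.leaves := fun h => hT.2.2 x h x hxr rfl
      simpa [nuAux, hasLeaf_iff, hxl, h5] using hr hT.2.1 hxr (k - 1 - l.numEdges) (n + 1)
    · by_cases hxl : x ∈ l.leaves
      · simp [nuAux, hasLeaf_iff, hxl]
      · have hxr : x ∈ r.leaves := by simpa [leaves, hxl] using hx
        simpa [nuAux, hasLeaf_iff, hxl, h5] using hr hT.2.1 hxr (k - 1 - l.numEdges) (n + 1)

open Classical in
theorem nu_insertAt_right {T T' : PlaneTree α} (hT' : T'.leaves.Nodup) {x : α}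
    (hx : x ∈ T'.leaves) (hxT : x ∉ T.leaves) (k : ℕ) :
    (T.insertAt k T').nu x = T'.nu x + if T'.owner k = x then 1 else 0 :=
  nuAux_insertAt_right hT' hx hxT k 0

/-- `T` is attached as a left subtree, so no path from one of its leaves goes beyond its root. -/
theorem nu_insertAt_left {T T' : PlaneTree α} {x : α} (hx : x ∈ T.leaves) (hxT' : x ∉ T'.leaves)
    (k : ℕ) : (T.insertAt k T').nu x = T.nu x := by
  unfold nu
  suffices H : ∀ n, (T.insertAt k T').nuAux x n = T.nuAux x 0 from H 0
  induction T' generalizing k with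
  | leaf y => intro n; simp [insertAt, nuAux, hasLeaf_iff, hx]
  | node l r hl hr =>
    intro n
    simp only [leaves, List.mem_append, not_or] at hxT'
    simp only [insertAt]
    split_ifs
    · simp [nuAux, hasLeaf_iff, hx]
    · simpa [nuAux, hasLeaf_iff, (leaves_insertAt_perm T l (k - 1)).mem_iff, hx] using
        hl hxT'.1 (k - 1) 0
    · simpa [nuAux, hasLeaf_iff, hxT'.1] using hr hxT'.2 (k - 1 - l.numEdges) (n + 1)

theorem nu_map {f : α → β} (hf : Function.Injective f) (T : PlaneTree α) (x : α) :
    (T.map f).nu (f x) = T.nu x := by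
  unfold nu
  generalize 0 = n
  induction T generalizing n with
  | leaf y => rfl
  | node l r hl hr =>
    have h : (l.map f).HasLeaf (f x) ↔ l.HasLeaf x := by
      rw [hasLeaf_iff, hasLeaf_iff, leaves_map, List.mem_map_of_injective hf]
    simp only [PlaneTree.map, nuAux, hl, hr]
    split_ifs <;> tauto

theorem owner_map (f : α → β) (T : PlaneTree α) (k : ℕ) : (T.map f).owner k = f (T.owner k) := by
  have hr : ∀ T : PlaneTree α, (T.map f).rightmost = f T.rightmost := by
    intro T
    induction T with
    | leaf => rfl
    | node l r hl hr => exact hr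
  induction T generalizing k with
  | leaf => rfl
  | node l r hl hr' =>
    simp only [PlaneTree.map, owner, numEdges_map, hl, hr', hr]
    split_ifs <;> rfl

open Classical in
-- Pre-order visits the edge above the root, owned by the rightmost leaf, then the edges of `l`,
-- then those of `r`.
theorem sum_owner_node {M : Type*} [AddCommMonoid M] (l r : PlaneTree α) (f : α → M) :
    ∑ k ∈ Finset.range (node l r).numEdges, f ((node l r).owner (k + 1)) =
      f r.rightmost + ∑ k ∈ Finset.range l.numEdges, f (l.owner (k + 1)) +
        ∑ k ∈ Finset.range r.numEdges, f (r.owner (k + 1)) := by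
  rw [numEdges, Finset.sum_range_add, Nat.add_comm 1, Finset.sum_range_succ']
  rw [add_comm (f r.rightmost)]
  congr 1
  · congr 1
    refine Finset.sum_congr rfl fun k hk => ?_
    have := Finset.mem_range.1 hk
    simp only [owner]
    rw [if_neg (by omega), if_pos (by omega)]
    rfl
  · refine Finset.sum_congr rfl fun k hk => ?_
    simp only [owner]
    rw [if_neg (by omega), if_neg (by omega)]
    congr 2
    omega

open Classical in
-- A leaf owns the `ν` right edges of its path and, in addition, the left or virtual edge at which
-- the path stops.
theorem card_owner {T : PlaneTree α} (hT : T.leaves.Nodup) {x : α} (hx : x ∈ T.leaves) :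
    ∑ k ∈ Finset.range T.numEdges, (if T.owner (k + 1) = x then 1 else 0) = T.nu x + 1 := by
  have hz : ∀ T : PlaneTree α, x ∉ T.leaves →
      ∑ k ∈ Finset.range T.numEdges, (if T.owner (k + 1) = x then 1 else 0) = 0 := by
    intro T h
    refine Finset.sum_eq_zero fun k _ => if_neg ?_
    rintro rfl
    exact h (T.owner_mem _)
  unfold nu
  induction T with
  | leaf y =>
    obtain rfl : x = y := by simpa [leaves] using hx
    simp [numEdges, owner, nuAux]
  | node l r hl hr =>
    rw [sum_owner_node l r (fun y => if y = x then 1 else 0)]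
    simp only [leaves, List.nodup_append] at hT
    simp only [nuAux, hasLeaf_iff]
    by_cases h1 : x ∈ l.leaves
    · have hxr : x ∉ r.leaves := fun h => hT.2.2 x h1 x h rfl
      have h2 : r.rightmost ≠ x := fun h => hxr (h ▸ r.rightmost_mem)
      rw [hl hT.1 h1, hz r hxr, if_neg h2, if_pos h1]; omega
    · have hxr : x ∈ r.leaves := by simpa [leaves, h1] using hx
      have := nuAux_succ hT.2.1 hxr 0
      rw [hr hT.2.1 hxr, hz l h1, if_neg h1]
      omega

open Classical in
theorem sum_owner {R : Type*} [Semiring R] {T : PlaneTree α} (hT : T.leaves.Nodup)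
    {S : Finset α} (hS : ∀ x, x ∈ S ↔ x ∈ T.leaves) (f : α → R) :
    ∑ k ∈ Finset.range T.numEdges, f (T.owner (k + 1)) = ∑ x ∈ S, ((T.nu x : R) + 1) * f x := by
  calc _ = ∑ k ∈ Finset.range T.numEdges, ∑ x ∈ S,
        (if T.owner (k + 1) = x then 1 else 0) * f x := by
        refine Finset.sum_congr rfl fun k _ => ?_
        simp [(hS _).2 (T.owner_mem (k + 1))]
    _ = _ := by
        rw [Finset.sum_comm]
        refine Finset.sum_congr rfl fun x hx => ?_
        rw [← Finset.sum_mul]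
        congr 1
        exact_mod_cast congrArg (Nat.cast (R := R)) (card_owner hT ((hS x).1 hx))

end PlaneTree

theorem leaves_insertionTree_perm {α : Type*} [LinearOrder α] (D : α → α) (S : Finset α)
    (h : S.Nonempty) : (insertionTree D S h).leaves.Perm S.toList := by
  induction S using Finset.strongInduction with
  | H S ih =>
    by_cases hc : (firstComponent D S h).Nonempty
    · have hsub : firstComponent D S h ⊆ S :=
        (firstComponent_subset D S h).trans (Finset.erase_subset _ _)
      have h1 : S \ firstComponent D S h ⊂ S := Finset.sdiff_ssubset hsub hc
      have h2 : firstComponent D S h ⊂ S :=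
        (firstComponent_subset D S h).trans_ssubset (Finset.erase_ssubset (S.min'_mem h))
      rw [insertionTree_eq_insertAt D h rfl rfl hc ⟨_, min'_mem_sdiff_firstComponent D S h⟩]
      refine (PlaneTree.leaves_insertAt_perm _ _ _).trans
        (((ih _ h1 _).append (ih _ h2 _)).trans ?_)
      rw [← Multiset.coe_eq_coe, ← Multiset.coe_add, Finset.coe_toList, Finset.coe_toList,
        Finset.coe_toList, Finset.sdiff_val]
      exact tsub_add_cancel_of_le (Finset.val_le_iff.2 hsub)
    · rw [insertionTree_of_not_nonempty D S h hc]
      have : ¬ (S.erase (S.min' h)).Nonempty := fun h' => hc (firstComponent_nonempty h h')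
      rw [Finset.not_nonempty_iff_eq_empty] at this
      have hS := Finset.insert_erase (S.min'_mem h)
      rw [this, insert_empty_eq] at hS
      generalize S.min' h = x at hS
      subst hS
      simp [PlaneTree.leaves]

/-! ### Rooted and decorated diagrams and their embedded subdiagrams -/

namespace RootedChordDiagram

variable {n : ℕ} (C : RootedChordDiagram n)

theorem mem_chords {x : Fin (2 * n)} : x ∈ C.chords ↔ x < C.perm x := by
  simp [chords]

theorem mem_chords_or (x : Fin (2 * n)) : x ∈ C.chords ∨ C.perm x ∈ C.chords := by
  rw [mem_chords, mem_chords, perm_perm]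
  exact lt_or_gt_of_ne (C.apply_ne x).symm

theorem isConnected_iff : C.IsConnected ↔ Conn C.perm C.chords := connected_iff

theorem ext {C C' : RootedChordDiagram n} (h : ∀ x, C.perm x = C'.perm x) : C = C' := by
  obtain ⟨p, _, _⟩ := C
  obtain ⟨p', _, _⟩ := C'
  obtain rfl : p = p' := Equiv.ext h
  rfl

/-- A rooted chord diagram from an involution. -/
def ofInvolution (p : Equiv.Perm (Fin (2 * n))) (h : ∀ x, p (p x) = x) (h' : ∀ x, p x ≠ x) :
    RootedChordDiagram n where
  perm := p
  sq_eq_one := by ext x; simp [pow_two, h]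
  apply_ne := h'

end RootedChordDiagram

namespace DecDiagram

variable {Δ : Set ℕ+}

/-- The decoration of the chord with smaller endpoint `x`, and `1` if there is no such chord. -/
def decAt (C : DecDiagram Δ) (x : Fin (2 * C.size)) : ℕ+ :=
  if h : x ∈ C.diagram.chords then C.d ⟨x, h⟩ else 1

theorem decAt_coe (C : DecDiagram Δ) (c : C.Chord) : C.decAt c = C.d c := by
  simp [decAt]

theorem conn (C : DecDiagram Δ) : Conn C.diagram.perm C.diagram.chords :=
  connected_iff.1 C.connected

theorem size_pos (C : DecDiagram Δ) : 0 < C.size := by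
  rw [← C.diagram.card_chords]
  exact C.chords_nonempty.card_pos

/-- The first point, representing the root chord. -/
def root (C : DecDiagram Δ) : Fin (2 * C.size) := ⟨0, by have := C.size_pos; omega⟩

theorem root_le (C : DecDiagram Δ) (x : Fin (2 * C.size)) : C.root ≤ x := by
  simp [root, Fin.le_def]

theorem root_mem (C : DecDiagram Δ) : C.root ∈ C.diagram.chords :=
  C.diagram.mem_chords.2 (lt_of_le_of_ne (C.root_le _) (C.diagram.apply_ne _).symm)

theorem min'_chords (C : DecDiagram Δ) (h : C.diagram.chords.Nonempty) :
    C.diagram.chords.min' h = C.root :=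
  le_antisymm (Finset.min'_le _ _ C.root_mem) (C.root_le _)

theorem lt_perm_of_mem {C : DecDiagram Δ} {x : Fin (2 * C.size)} (h : x ∈ C.diagram.chords) :
    x < C.diagram.perm x := C.diagram.mem_chords.1 h

theorem perm_ne_root {C : DecDiagram Δ} {x : Fin (2 * C.size)} (h : x ∈ C.diagram.chords) :
    C.diagram.perm x ≠ C.root :=
  ((C.root_le x).trans_lt (lt_perm_of_mem h)).ne'

theorem ext_of {n : ℕ} {C C' : RootedChordDiagram n} {hC : C.IsConnected} {hC' : C'.IsConnected}
    {d : C.chords → Δ} {d' : C'.chords → Δ} (h : C = C')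
    (hd : ∀ x hx hx', (d ⟨x, hx⟩ : ℕ+) = d' ⟨x, hx'⟩) :
    (⟨n, C, hC, d⟩ : DecDiagram Δ) = ⟨n, C', hC', d'⟩ := by
  subst h
  congr 1
  funext x
  exact Subtype.ext (hd x.1 x.2 x.2)

/-- A subdiagram: an order embedding of the points compatible with chords and decorations. -/
structure Emb (B C : DecDiagram Δ) where
  e : Fin (2 * B.size) ↪o Fin (2 * C.size)
  comm : ∀ x, e (B.diagram.perm x) = C.diagram.perm (e x)
  dec : ∀ x, C.decAt (e x) = B.decAt x

namespace Emb

variable {B B₁ B₂ C : DecDiagram Δ}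

theorem mem_chords (f : Emb B C) {x : Fin (2 * B.size)} :
    f.e x ∈ C.diagram.chords ↔ x ∈ B.diagram.chords := by
  rw [RootedChordDiagram.mem_chords, RootedChordDiagram.mem_chords, ← f.comm, f.e.lt_iff_lt]

/-- Every point is an endpoint of a chord, so the image of the chords determines the image of all
points. -/
theorem range_eq (f : Emb B C) : Set.range f.e =
    {y | y ∈ B.diagram.chords.map f.e.toEmbedding ∨
      C.diagram.perm y ∈ B.diagram.chords.map f.e.toEmbedding} := by
  have hm : ∀ x, f.e x ∈ B.diagram.chords.map f.e.toEmbedding ↔ x ∈ B.diagram.chords :=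
    fun x => Finset.mem_map' f.e.toEmbedding
  ext y
  constructor
  · rintro ⟨x, rfl⟩
    simp only [Set.mem_ofPred_eq, ← f.comm, hm]
    exact B.diagram.mem_chords_or x
  · rintro (h | h)
    · obtain ⟨x, _, rfl⟩ := Finset.mem_map.1 h
      exact ⟨x, rfl⟩
    · obtain ⟨x, _, hx⟩ := Finset.mem_map.1 h
      exact ⟨B.diagram.perm x, by
        rw [f.comm]; exact (congrArg _ hx).trans (C.diagram.perm_perm y)⟩

/-- An order embedding of a finite chain is determined by its range; involution and decorations are
then pulled back from `C`. -/
theorem eq_of_range_eq (f₁ : Emb B₁ C) (f₂ : Emb B₂ C) (h : Set.range f₁.e = Set.range f₂.e) :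
    B₁ = B₂ := by
  have hn : B₁.size = B₂.size := by
    have h1 := Set.ncard_range_of_injective f₁.e.injective
    have h2 := Set.ncard_range_of_injective f₂.e.injective
    rw [h, h2] at h1
    simp only [Nat.card_eq_fintype_card, Fintype.card_fin] at h1
    omega
  obtain ⟨e₁, c₁, d₁⟩ := f₁
  obtain ⟨e₂, c₂, d₂⟩ := f₂
  obtain ⟨n, D, hD, d⟩ := B₁
  obtain ⟨n', D', hD', d'⟩ := B₂
  dsimp only at *
  subst hn
  obtain rfl := OrderEmbedding.range_inj.1 h
  refine ext_of (RootedChordDiagram.ext fun x => ?_) fun x hx hx' => ?_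
  · exact e₁.injective ((c₁ x).trans (c₂ x).symm)
  · have := (d₁ x).symm.trans (d₂ x)
    simpa [decAt, hx, hx', DecDiagram.d] using this

theorem eq_of_map_eq (f₁ : Emb B₁ C) (f₂ : Emb B₂ C)
    (h : B₁.diagram.chords.map f₁.e.toEmbedding = B₂.diagram.chords.map f₂.e.toEmbedding) :
    B₁ = B₂ :=
  eq_of_range_eq f₁ f₂ (by rw [range_eq, range_eq, h])

/-- The identity. -/
def refl (C : DecDiagram Δ) : Emb C C := ⟨RelEmbedding.refl _, fun _ => rfl, fun _ => rfl⟩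

theorem eq_of_surjective (f : Emb B C) (h : Function.Surjective f.e) : B = C :=
  eq_of_range_eq f (refl C) (by rw [h.range_eq]; exact (Set.range_id).symm)

end Emb

/-- The `2|T|` endpoints of the chords in `T` are stable under the involution; numbering them
increasingly yields a diagram of its own. -/
theorem exists_emb (C : DecDiagram Δ) {T : Finset (Fin (2 * C.size))}
    (hT : T ⊆ C.diagram.chords) (hc : Conn C.diagram.perm T) :
    ∃ (B : DecDiagram Δ) (f : Emb B C), B.diagram.chords.map f.e.toEmbedding = T := by
  classical
  have hinj : Function.Injective C.diagram.perm := C.diagram.perm.injective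
  have hpp := C.diagram.perm_perm
  have hdisj : Disjoint T (T.image C.diagram.perm) := by
    rw [Finset.disjoint_left]
    intro x hx hx'
    obtain ⟨y, hy, rfl⟩ := Finset.mem_image.1 hx'
    have h1 := C.diagram.mem_chords.1 (hT hx)
    have h2 := C.diagram.mem_chords.1 (hT hy)
    rw [hpp] at h1
    exact lt_asymm h1 h2
  set P := T ∪ T.image C.diagram.perm with hP
  have hcard : P.card = 2 * T.card := by
    rw [hP, Finset.card_union_of_disjoint hdisj, Finset.card_image_of_injective _ hinj]; omega
  have hmemP : ∀ y, y ∈ P ↔ y ∈ T ∨ C.diagram.perm y ∈ T := by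
    intro y
    rw [hP, Finset.mem_union, Finset.mem_image]
    refine or_congr_right ⟨?_, fun h => ⟨_, h, hpp y⟩⟩
    rintro ⟨x, hx, rfl⟩
    rwa [hpp]
  have hpP : ∀ y, C.diagram.perm y ∈ P ↔ y ∈ P := by
    intro y
    rw [hmemP, hmemP, hpp, or_comm]
  let i := P.orderIsoOfFin hcard
  let e : Fin (2 * T.card) ↪o Fin (2 * C.size) :=
    i.toOrderEmbedding.trans (OrderEmbedding.subtype _)
  let p : Equiv.Perm (Fin (2 * T.card)) :=
    i.toEquiv.trans ((C.diagram.perm.subtypePerm hpP).trans i.toEquiv.symm)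
  have hcomm : ∀ x, e (p x) = C.diagram.perm (e x) := by
    intro x
    simp [e, p]
  have heP : ∀ x, e x ∈ P := fun x => (i x).2
  let B : RootedChordDiagram T.card := RootedChordDiagram.ofInvolution p
    (fun x => e.injective (by rw [hcomm, hcomm, hpp]))
    (fun x h => C.diagram.apply_ne (e x) (by rw [← hcomm, h]))
  have hch : ∀ x, x ∈ B.chords ↔ e x ∈ T := by
    intro x
    rw [B.mem_chords]
    change x < p x ↔ _
    rw [← e.lt_iff_lt, hcomm]
    constructor
    · intro h
      rcases (hmemP _).1 (heP x) with h1 | h1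
      · exact h1
      · have := C.diagram.mem_chords.1 (hT h1)
        rw [hpp] at this
        exact absurd h this.not_gt
    · intro h
      exact C.diagram.mem_chords.1 (hT h)
  have hmap : B.chords.map e.toEmbedding = T := by
    ext y
    rw [Finset.mem_map]
    constructor
    · rintro ⟨x, hx, rfl⟩
      exact (hch x).1 hx
    · intro hy
      obtain ⟨x, hx⟩ := i.surjective ⟨y, (hmemP y).2 (.inl hy)⟩
      have hx' : e x = y := congrArg Subtype.val hx
      exact ⟨x, (hch x).2 (hx' ▸ hy), hx'⟩
  have hB : B.IsConnected := by
    rw [B.isConnected_iff]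
    rw [← hmap] at hc
    exact (conn_map (E := B.perm) hcomm).1 hc
  refine ⟨⟨T.card, B, hB, fun c => C.dec ⟨e c, hT ((hch c).1 c.2)⟩⟩, ⟨e, hcomm, ?_⟩, hmap⟩
  intro x
  by_cases hx : x ∈ B.chords
  · have hx' := hT ((hch x).1 hx)
    simp only [decAt]
    rw [dif_pos hx', dif_pos hx]
    rfl
  · have hx' : e x ∉ C.diagram.chords := by
      rw [C.diagram.mem_chords, ← hcomm, e.lt_iff_lt]
      exact fun h => hx (B.mem_chords.2 h)
    simp only [decAt]
    rw [dif_neg hx', dif_neg hx]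

end DecDiagram
-- The root share decomposition: uniqueness and existence
namespace DecDiagram

variable {Δ : Set ℕ+}

/-- `l` and `r` embed the points of `C'` and `C''` into a diagram with involution `D` such that it
becomes `C' ∘_k C''`: the root of `C'` comes first, the other points of `C'` are inserted between
the `k`-th and the `(k+1)`-st point of `C''`. -/
structure Splice {α : Type*} [LinearOrder α] (D : α → α) (C' C'' : DecDiagram Δ) (k : ℕ)
    (l : Fin (2 * C'.size) ↪o α) (r : Fin (2 * C''.size) ↪o α) : Prop where
  comm_left : ∀ x, l (C'.diagram.perm x) = D (l x)
  comm_right : ∀ x, r (C''.diagram.perm x) = D (r x)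
  ne : ∀ x y, l x ≠ r y
  cover : ∀ z, (∃ x, l x = z) ∨ ∃ y, r y = z
  root_lt : ∀ y, l C'.root < r y
  lt_iff : ∀ x y, x ≠ C'.root → (r y < l x ↔ y.val < k)
  one_le : 1 ≤ k
  lt : k < 2 * C''.size

namespace Splice

variable {α : Type*} [LinearOrder α] {D : α → α} {C' C'' : DecDiagram Δ} {k : ℕ}
  {l : Fin (2 * C'.size) ↪o α} {r : Fin (2 * C''.size) ↪o α}

theorem lt_iff' (h : Splice D C' C'' k l r) {x : Fin (2 * C'.size)} {y : Fin (2 * C''.size)}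
    (hx : x ≠ C'.root) : l x < r y ↔ k ≤ y.val := by
  rw [← not_lt (a := y.val), ← h.lt_iff x y hx, not_lt]
  exact ⟨le_of_lt, fun h' => lt_of_le_of_ne h' (h.ne x y)⟩

/-- Both endpoints of a non-root chord of `C'` lie in the same gap of `C''`, so they cannot be
separated by a chord of `C''`. -/
theorem not_crosses (h : Splice D C' C'' k l r) {x : Fin (2 * C'.size)} {y : Fin (2 * C''.size)}
    (hx : x ∈ C'.diagram.chords) (hx' : x ≠ C'.root) : ¬ Crosses D (l x) (r y) := by
  have hDx := perm_ne_root hx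
  simp only [Crosses, ← h.comm_left, ← h.comm_right, h.lt_iff _ _ hx', h.lt_iff _ _ hDx,
    h.lt_iff' hx', h.lt_iff' hDx]
  omega

theorem crosses_root_iff (h : Splice D C' C'' k l r) {y : Fin (2 * C''.size)} :
    Crosses D (l C'.root) (r y) ↔ y.val < k ∧ k ≤ (C''.diagram.perm y).val := by
  have hD := perm_ne_root C'.root_mem
  simp only [Crosses, ← h.comm_left, ← h.comm_right, h.lt_iff _ _ hD, h.lt_iff' hD]
  simp only [h.root_lt, (h.root_lt _).not_gt, true_and, false_and, or_false]

/-- If no chord straddled the gap, starting before it would spread from the root along crossings to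
all chords; then every point, even the last, would lie before the gap. -/
theorem exists_straddling {C : DecDiagram Δ} {k : ℕ} (h1 : 1 ≤ k) (h2 : k < 2 * C.size) :
    ∃ y ∈ C.diagram.chords, y.val < k ∧ k ≤ (C.diagram.perm y).val := by
  by_contra! hcon
  have key := C.conn.induction (p := fun y => y.val < k) C.root_mem h1 (by
    intro u hu v hv huk huv
    have := hcon u hu huk
    have hv' := lt_perm_of_mem hv
    rcases huv with h | h
    · exact lt_trans (Fin.lt_def.1 h.2.1) this
    · exact lt_trans (Fin.lt_def.1 h.1) huk)
  rcases C.diagram.mem_chords_or ⟨2 * C.size - 1, by omega⟩ with hm | hm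
  · have := key _ hm
    simp only at this
    omega
  · have := hcon _ hm (key _ hm)
    rw [C.diagram.perm_perm] at this
    simp only at this
    omega

theorem exists_crosses_root (h : Splice D C' C'' k l r) :
    ∃ y ∈ C''.diagram.chords, Crosses D (l C'.root) (r y) := by
  obtain ⟨y, hy, h'⟩ := exists_straddling h.one_le h.lt
  exact ⟨y, hy, h.crosses_root_iff.2 h'⟩

theorem conn (h : Splice D C' C'' k l r) : Conn D
    (C'.diagram.chords.map l.toEmbedding ∪ C''.diagram.chords.map r.toEmbedding) := by
  have hl := (conn_map (D := D) (E := C'.diagram.perm) h.comm_left).2 C'.conn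
  have hr := (conn_map (D := D) (E := C''.diagram.perm) h.comm_right).2 C''.conn
  have hroot := Finset.mem_map_of_mem l.toEmbedding C'.root_mem
  obtain ⟨y, hy, hcr⟩ := h.exists_crosses_root
  have hy' := Finset.mem_map_of_mem r.toEmbedding hy
  refine Conn.of_root (Finset.mem_union_left _ hroot) fun z hz => ?_
  rcases Finset.mem_union.1 hz with hz | hz
  · exact Relation.ReflTransGen.mono (fun _ _ h => h.mono Finset.subset_union_left) _ _
      (hl.2 _ hroot _ hz)
  · exact .head ⟨Finset.mem_union_left _ hroot, Finset.mem_union_right _ hy', hcr⟩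
      (Relation.ReflTransGen.mono (fun _ _ h => h.mono Finset.subset_union_right) _ _
        (hr.2 _ hy' _ hz))

end Splice

/-- `C` is the composition `C' ∘_k C''`. -/
structure Decomp (C C' C'' : DecDiagram Δ) (k : ℕ) where
  l : Fin (2 * C'.size) ↪o Fin (2 * C.size)
  r : Fin (2 * C''.size) ↪o Fin (2 * C.size)
  splice : Splice C.diagram.perm C' C'' k l r
  dec_left : ∀ x, C.decAt (l x) = C'.decAt x
  dec_right : ∀ x, C.decAt (r x) = C''.decAt x

namespace Decomp

variable {C C₁ C₂ C' C'' C₁' C₁'' C₂' C₂'' : DecDiagram Δ} {k k₁ k₂ : ℕ}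

/-- The embedding of `C'`. -/
def left (h : Decomp C C' C'' k) : Emb C' C := ⟨h.l, h.splice.comm_left, h.dec_left⟩

/-- The embedding of `C''`. -/
def right (h : Decomp C C' C'' k) : Emb C'' C := ⟨h.r, h.splice.comm_right, h.dec_right⟩

theorem l_mem (h : Decomp C C' C'' k) {x : Fin (2 * C'.size)} :
    h.l x ∈ C.diagram.chords ↔ x ∈ C'.diagram.chords := h.left.mem_chords

theorem r_mem (h : Decomp C C' C'' k) {x : Fin (2 * C''.size)} :
    h.r x ∈ C.diagram.chords ↔ x ∈ C''.diagram.chords := h.right.mem_chords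

theorem disjoint (h : Decomp C C' C'' k) : Disjoint (C'.diagram.chords.map h.l.toEmbedding)
    (C''.diagram.chords.map h.r.toEmbedding) := by
  rw [Finset.disjoint_left]
  intro z hz hz'
  obtain ⟨x, _, rfl⟩ := Finset.mem_map.1 hz
  obtain ⟨y, _, hy⟩ := Finset.mem_map.1 hz'
  exact h.splice.ne x y hy.symm

theorem chords_eq (h : Decomp C C' C'' k) : C.diagram.chords =
    C'.diagram.chords.map h.l.toEmbedding ∪ C''.diagram.chords.map h.r.toEmbedding := by
  ext z
  rw [Finset.mem_union, Finset.mem_map, Finset.mem_map]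
  constructor
  · intro hz
    rcases h.splice.cover z with ⟨x, rfl⟩ | ⟨y, rfl⟩
    · exact .inl ⟨x, h.l_mem.1 hz, rfl⟩
    · exact .inr ⟨y, h.r_mem.1 hz, rfl⟩
  · rintro (⟨x, hx, rfl⟩ | ⟨y, hy, rfl⟩)
    · exact h.l_mem.2 hx
    · exact h.r_mem.2 hy

theorem size_eq (h : Decomp C C' C'' k) : C.size = C'.size + C''.size := by
  have := congrArg Finset.card h.chords_eq
  rwa [Finset.card_union_of_disjoint h.disjoint, Finset.card_map, Finset.card_map,
    RootedChordDiagram.card_chords, RootedChordDiagram.card_chords,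
    RootedChordDiagram.card_chords] at this

theorem l_root (h : Decomp C C' C'' k) : h.l C'.root = C.root := by
  refine le_antisymm ?_ (C.root_le _)
  rcases h.splice.cover C.root with ⟨x, hx⟩ | ⟨y, hy⟩
  · rw [← hx]; exact h.l.le_iff_le.2 (C'.root_le x)
  · rw [← hy]; exact (h.splice.root_lt y).le

theorem mem_erase_root (h : Decomp C C' C'' k) {z : Fin (2 * C.size)} :
    z ∈ C.diagram.chords.erase C.root ↔
      (∃ x ∈ C'.diagram.chords, x ≠ C'.root ∧ h.l x = z) ∨ ∃ y ∈ C''.diagram.chords, h.r y = z := by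
  rw [Finset.mem_erase, h.chords_eq, Finset.mem_union, Finset.mem_map, Finset.mem_map, ← h.l_root]
  constructor
  · rintro ⟨h1, ⟨x, hx, rfl⟩ | ⟨y, hy, rfl⟩⟩
    · exact .inl ⟨x, hx, fun e => h1 (congrArg h.l e), rfl⟩
    · exact .inr ⟨y, hy, rfl⟩
  · rintro (⟨x, hx, hx', rfl⟩ | ⟨y, hy, rfl⟩)
    · exact ⟨fun e => hx' (h.l.injective e), .inl ⟨x, hx, rfl⟩⟩
    · exact ⟨fun e => h.splice.ne _ _ e.symm, .inr ⟨y, hy, rfl⟩⟩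

/-- As `k ≥ 1`, the first point of `C''` precedes all non-root points of `C'`; and `C''` is
connected and crosses no non-root chord of `C'`. -/
theorem firstComponent_eq (h : Decomp C C' C'' k) (hne : C.diagram.chords.Nonempty) :
    firstComponent C.diagram.perm C.diagram.chords hne =
      C''.diagram.chords.map h.r.toEmbedding := by
  have hroot := h.r_mem.2 C''.root_mem
  have hmem : h.r C''.root ∈ C.diagram.chords.erase C.root :=
    h.mem_erase_root.2 (.inr ⟨_, C''.root_mem, rfl⟩)
  have hne' : (C.diagram.chords.erase C.root).Nonempty := ⟨_, hmem⟩
  have hmin : (C.diagram.chords.erase C.root).min' hne' = h.r C''.root := by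
    refine le_antisymm (Finset.min'_le _ _ hmem) (Finset.le_min' _ _ _ fun z hz => ?_)
    rcases h.mem_erase_root.1 hz with ⟨x, hx, hx', rfl⟩ | ⟨y, hy, rfl⟩
    · exact ((h.splice.lt_iff x C''.root hx').2 (show 0 < k from h.splice.one_le)).le
    · exact h.r.le_iff_le.2 (C''.root_le y)
  simp only [firstComponent, min'_chords]
  rw [dif_pos hne', hmin]
  refine component_eq
    ((conn_map (D := C.diagram.perm) (E := C''.diagram.perm) h.splice.comm_right).2 C''.conn)
    ?_ (Finset.mem_map_of_mem _ C''.root_mem) ?_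
  · intro z hz
    obtain ⟨y, hy, rfl⟩ := Finset.mem_map.1 hz
    exact h.mem_erase_root.2 (.inr ⟨y, hy, rfl⟩)
  · intro u hu v hv huv
    obtain ⟨y, hy, rfl⟩ := Finset.mem_map.1 hu
    rcases h.mem_erase_root.1 hv with ⟨x, hx, hx', rfl⟩ | ⟨y, hy, rfl⟩
    · exact absurd huv.symm (h.splice.not_crosses hx hx')
    · exact Finset.mem_map_of_mem _ hy

theorem sdiff_eq (h : Decomp C C' C'' k) :
    C.diagram.chords \ C''.diagram.chords.map h.r.toEmbedding =
      C'.diagram.chords.map h.l.toEmbedding := by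
  rw [h.chords_eq, Finset.union_sdiff_cancel_right h.disjoint]

theorem insertionPlace_eq (h : Decomp C C' C'' k) (hne : C.diagram.chords.Nonempty) :
    insertionPlace C.diagram.perm C.diagram.chords hne = k := by
  have hu : C''.diagram.chords.map h.r.toEmbedding ∪
      (C''.diagram.chords.map h.r.toEmbedding).image C.diagram.perm =
      Finset.univ.map h.r.toEmbedding := by
    ext z
    rw [Finset.mem_union, Finset.mem_image]
    constructor
    · rintro (hz | ⟨w, hw, rfl⟩)
      · obtain ⟨y, _, rfl⟩ := Finset.mem_map.1 hz
        exact Finset.mem_map_of_mem _ (Finset.mem_univ _)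
      · obtain ⟨y, _, rfl⟩ := Finset.mem_map.1 hw
        exact Finset.mem_map.2 ⟨_, Finset.mem_univ _, h.splice.comm_right y⟩
    · intro hz
      obtain ⟨y, _, rfl⟩ := Finset.mem_map.1 hz
      rcases C''.diagram.mem_chords_or y with hy | hy
      · exact .inl (Finset.mem_map_of_mem _ hy)
      · exact .inr ⟨_, Finset.mem_map_of_mem _ hy, (h.splice.comm_right _).symm.trans
          (congrArg h.r (C''.diagram.perm_perm y))⟩
  rw [insertionPlace, h.firstComponent_eq, hu, min'_chords, ← h.l_root, ← h.splice.comm_left,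
    Finset.filter_map, Finset.card_map]
  have : (Finset.univ.filter ((fun z => z < h.l (C'.diagram.perm C'.root)) ∘ h.r.toEmbedding)) =
      Finset.Iio (⟨k, h.splice.lt⟩ : Fin (2 * C''.size)) := by
    ext y
    simp only [Function.comp_apply, Finset.mem_filter, Finset.mem_univ, true_and, Finset.mem_Iio]
    exact h.splice.lt_iff _ y (perm_ne_root C'.root_mem)
  rw [this, Fin.card_Iio]

/-- The relative order of any two points is dictated by `C'`, `C''` and `k`, so matching points by
their origin is an isomorphism. -/
theorem eq_of_parts (h₁ : Decomp C₁ C' C'' k) (h₂ : Decomp C₂ C' C'' k) : C₁ = C₂ := by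
  have H : ∀ z, ∃ w, (∃ x, z = h₁.l x ∧ w = h₂.l x) ∨ ∃ y, z = h₁.r y ∧ w = h₂.r y := by
    intro z
    rcases h₁.splice.cover z with ⟨x, rfl⟩ | ⟨y, rfl⟩
    · exact ⟨_, .inl ⟨x, rfl, rfl⟩⟩
    · exact ⟨_, .inr ⟨y, rfl, rfl⟩⟩
  choose φ hφ using H
  have hl : ∀ x, φ (h₁.l x) = h₂.l x := by
    intro x
    rcases hφ (h₁.l x) with ⟨x', h1, h2⟩ | ⟨y, h1, h2⟩
    · rw [h2, h₁.l.injective h1]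
    · exact absurd h1 (h₁.splice.ne _ _)
  have hr : ∀ x, φ (h₁.r x) = h₂.r x := by
    intro x
    rcases hφ (h₁.r x) with ⟨x', h1, h2⟩ | ⟨y, h1, h2⟩
    · exact absurd h1.symm (h₁.splice.ne _ _)
    · rw [h2, h₁.r.injective h1]
  have hmono : StrictMono φ := by
    intro z z' hz
    rcases h₁.splice.cover z with ⟨x, rfl⟩ | ⟨y, rfl⟩ <;>
    rcases h₁.splice.cover z' with ⟨x', rfl⟩ | ⟨y', rfl⟩
    · simp only [hl]
      exact h₂.l.lt_iff_lt.2 (h₁.l.lt_iff_lt.1 hz)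
    · simp only [hl, hr]
      by_cases hx : x = C'.root
      · rw [hx]; exact h₂.splice.root_lt _
      · exact (h₂.splice.lt_iff' hx).2 ((h₁.splice.lt_iff' hx).1 hz)
    · simp only [hl, hr]
      have hx : x' ≠ C'.root := by
        rintro rfl
        exact hz.not_gt (h₁.splice.root_lt _)
      exact (h₂.splice.lt_iff _ _ hx).2 ((h₁.splice.lt_iff _ _ hx).1 hz)
    · simp only [hr]
      exact h₂.r.lt_iff_lt.2 (h₁.r.lt_iff_lt.1 hz)
  refine Emb.eq_of_surjective ⟨OrderEmbedding.ofStrictMono φ hmono, fun z => ?_, fun z => ?_⟩ ?_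
  · simp only [OrderEmbedding.coe_ofStrictMono]
    rcases h₁.splice.cover z with ⟨x, rfl⟩ | ⟨y, rfl⟩
    · rw [← h₁.splice.comm_left, hl, hl, h₂.splice.comm_left]
    · rw [← h₁.splice.comm_right, hr, hr, h₂.splice.comm_right]
  · simp only [OrderEmbedding.coe_ofStrictMono]
    rcases h₁.splice.cover z with ⟨x, rfl⟩ | ⟨y, rfl⟩
    · rw [hl, h₁.dec_left, h₂.dec_left]
    · rw [hr, h₁.dec_right, h₂.dec_right]
  · intro w
    rcases h₂.splice.cover w with ⟨x, rfl⟩ | ⟨y, rfl⟩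
    · exact ⟨_, hl x⟩
    · exact ⟨_, hr y⟩

/-- `C''` is recovered as the first component, `C'` as its complement, and `k` as the insertion
place. -/
theorem parts_eq (h₁ : Decomp C C₁' C₁'' k₁) (h₂ : Decomp C C₂' C₂'' k₂) :
    C₁' = C₂' ∧ C₁'' = C₂'' ∧ k₁ = k₂ := by
  have hne := C.chords_nonempty
  have h := (h₁.firstComponent_eq hne).symm.trans (h₂.firstComponent_eq hne)
  refine ⟨?_, ?_, ?_⟩
  · refine Emb.eq_of_map_eq h₁.left h₂.left ?_
    change C₁'.diagram.chords.map h₁.l.toEmbedding = C₂'.diagram.chords.map h₂.l.toEmbedding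
    rw [← h₁.sdiff_eq, ← h₂.sdiff_eq, h]
  · exact Emb.eq_of_map_eq h₁.right h₂.right h
  · rw [← h₁.insertionPlace_eq hne, ← h₂.insertionPlace_eq hne]

end Decomp

theorem exists_comp (C' C'' : DecDiagram Δ) {k : ℕ} (h1 : 1 ≤ k) (h2 : k < 2 * C''.size) :
    ∃ C, Nonempty (Decomp C C' C'' k) := by
  classical
  have hm := C'.size_pos
  set m := C'.size with hm'
  set n := C''.size with hn'
  -- Positions are counted directly: the root stays at `0`, the first `k` points of `C''` follow it,
  -- then come the other `2m - 1` points of `C'`, and finally the rest of `C''`.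
  let l : Fin (2 * C'.size) ↪o Fin (2 * (m + n)) := OrderEmbedding.ofStrictMono
    (fun x => ⟨if x.val = 0 then 0 else x.val + k, by split_ifs <;> omega⟩) (by
      intro x y hxy
      rw [Fin.lt_def] at hxy ⊢
      dsimp only
      split_ifs <;> omega)
  let r : Fin (2 * C''.size) ↪o Fin (2 * (m + n)) := OrderEmbedding.ofStrictMono
    (fun x => ⟨if x.val < k then x.val + 1 else x.val + 2 * m, by split_ifs <;> omega⟩) (by
      intro x y hxy
      rw [Fin.lt_def] at hxy ⊢
      dsimp only
      split_ifs <;> omega)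
  have hl : ∀ x, (l x).val = if x.val = 0 then 0 else x.val + k := fun x => rfl
  have hr : ∀ x, (r x).val = if x.val < k then x.val + 1 else x.val + 2 * m := fun x => rfl
  have hne : ∀ x y, l x ≠ r y := by
    intro x y hxy
    have h := congrArg Fin.val hxy
    have hx : x.val < 2 * m := x.2
    rw [hl, hr] at h
    split_ifs at h <;> omega
  have hinj : Function.Injective (Sum.elim l r) :=
    l.injective.sumElim r.injective hne
  have hbij : Function.Bijective (Sum.elim l r) :=
    (Fintype.bijective_iff_injective_and_card _).2 ⟨hinj, by simp; omega⟩
  let φ := Equiv.ofBijective _ hbij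
  have hφl : ∀ x, φ.symm (l x) = Sum.inl x := fun x => φ.symm_apply_eq.2 rfl
  have hφr : ∀ x, φ.symm (r x) = Sum.inr x := fun x => φ.symm_apply_eq.2 rfl
  have hcover : ∀ z, (∃ x, l x = z) ∨ ∃ y, r y = z := by
    intro z
    obtain ⟨x | y, rfl⟩ := hbij.2 z
    · exact .inl ⟨x, rfl⟩
    · exact .inr ⟨y, rfl⟩
  let p : Equiv.Perm (Fin (2 * (m + n))) :=
    φ.symm.trans ((Equiv.sumCongr C'.diagram.perm C''.diagram.perm).trans φ)
  have hpl : ∀ x, l (C'.diagram.perm x) = p (l x) := by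
    intro x
    simp only [p, Equiv.trans_apply, hφl]
    rfl
  have hpr : ∀ x, r (C''.diagram.perm x) = p (r x) := by
    intro x
    simp only [p, Equiv.trans_apply, hφr]
    rfl
  let B : RootedChordDiagram (m + n) := RootedChordDiagram.ofInvolution p
    (fun z => by
      rcases hcover z with ⟨x, rfl⟩ | ⟨y, rfl⟩
      · rw [← hpl, ← hpl, C'.diagram.perm_perm]
      · rw [← hpr, ← hpr, C''.diagram.perm_perm])
    (fun z => by
      rcases hcover z with ⟨x, rfl⟩ | ⟨y, rfl⟩
      · rw [← hpl]; exact fun h => C'.diagram.apply_ne x (l.injective h)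
      · rw [← hpr]; exact fun h => C''.diagram.apply_ne y (r.injective h))
  have hml : ∀ x, l x ∈ B.chords ↔ x ∈ C'.diagram.chords := by
    intro x
    rw [B.mem_chords, C'.diagram.mem_chords]
    change l x < p (l x) ↔ _
    rw [← hpl, l.lt_iff_lt]
  have hmr : ∀ x, r x ∈ B.chords ↔ x ∈ C''.diagram.chords := by
    intro x
    rw [B.mem_chords, C''.diagram.mem_chords]
    change r x < p (r x) ↔ _
    rw [← hpr, r.lt_iff_lt]
  have hS : Splice B.perm C' C'' k l r :=
    { comm_left := hpl
      comm_right := hpr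
      ne := hne
      cover := hcover
      root_lt := fun y => by
        rw [Fin.lt_def, hl, hr, if_pos (by rfl)]
        split_ifs <;> omega
      lt_iff := fun x y hx => by
        have hx' : x.val ≠ 0 := fun h => hx (Fin.ext h)
        have hx2 : x.val < 2 * m := x.2
        rw [Fin.lt_def, hl, hr, if_neg hx']
        split_ifs <;> omega
      one_le := h1
      lt := h2 }
  have hchords : B.chords =
      C'.diagram.chords.map l.toEmbedding ∪ C''.diagram.chords.map r.toEmbedding := by
    ext z
    rw [Finset.mem_union, Finset.mem_map, Finset.mem_map]
    constructor
    · intro hz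
      rcases hcover z with ⟨x, rfl⟩ | ⟨y, rfl⟩
      · exact .inl ⟨x, (hml x).1 hz, rfl⟩
      · exact .inr ⟨y, (hmr y).1 hz, rfl⟩
    · rintro (⟨x, hx, rfl⟩ | ⟨y, hy, rfl⟩)
      · exact (hml x).2 hx
      · exact (hmr y).2 hy
  have hB : B.IsConnected := by
    rw [B.isConnected_iff, hchords]
    exact hS.conn
  have hdec : ∀ c : B.chords, ∃ d : Δ,
      (∀ x, l x = c → C'.decAt x = d) ∧ ∀ y, r y = c → C''.decAt y = d := by
    rintro ⟨z, hz⟩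
    rcases hcover z with ⟨x, rfl⟩ | ⟨y, rfl⟩
    · have hx := (hml x).1 hz
      refine ⟨C'.dec ⟨x, hx⟩, fun x' hx' => ?_, fun y hy => absurd hy.symm (hne x y)⟩
      obtain rfl := l.injective hx'
      exact decAt_coe C' ⟨x', hx⟩
    · have hy := (hmr y).1 hz
      refine ⟨C''.dec ⟨y, hy⟩, fun x hx => absurd hx (hne x y), fun y' hy' => ?_⟩
      obtain rfl := r.injective hy'
      exact decAt_coe C'' ⟨y', hy⟩
  choose d hdl hdr using hdec
  refine ⟨⟨m + n, B, hB, d⟩, ⟨⟨l, r, hS, fun x => ?_, fun x => ?_⟩⟩⟩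
  · by_cases hx : x ∈ C'.diagram.chords
    · rw [hdl ⟨l x, (hml x).2 hx⟩ x rfl]
      exact dif_pos ((hml x).2 hx)
    · simp only [decAt]
      rw [dif_neg hx]
      exact dif_neg (fun h => hx ((hml x).1 h))
  · by_cases hx : x ∈ C''.diagram.chords
    · rw [hdr ⟨r x, (hmr x).2 hx⟩ x rfl]
      exact dif_pos ((hmr x).2 hx)
    · simp only [decAt]
      rw [dif_neg hx]
      exact dif_neg (fun h => hx ((hmr x).1 h))

/-- A downward closed subset of `Fin n` is an initial segment. This lets the insertion place be
defined as a cardinality. -/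
theorem lt_card_filter_iff {n : ℕ} {p : Fin n → Prop} [DecidablePred p]
    (hp : ∀ x y, x ≤ y → p y → p x) (y : Fin n) :
    y.val < (Finset.univ.filter p).card ↔ p y := by
  constructor
  · intro h
    by_contra hy
    have : Finset.univ.filter p ⊆ Finset.Iio y := by
      intro x hx
      rw [Finset.mem_Iio]
      by_contra hxy
      exact hy (hp y x (not_lt.1 hxy) (Finset.mem_filter.1 hx).2)
    have := Finset.card_le_card this
    rw [Fin.card_Iio] at this
    omega
  · intro h
    have : Finset.Iic y ⊆ Finset.univ.filter p := fun x hx =>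
      Finset.mem_filter.2 ⟨Finset.mem_univ _, hp x y (Finset.mem_Iic.1 hx) h⟩
    have := Finset.card_le_card this
    rw [Fin.card_Iic] at this
    omega

/-- The parts are the first component `T''` of the non-root chords and its complement. The point to
prove is that all endpoints of the complement, except the first point, lie in one gap of `T''`. -/
theorem exists_decomp (C : DecDiagram Δ) (hC : 2 ≤ C.size) :
    ∃ C' C'' k, Nonempty (Decomp C C' C'' k) := by
  classical
  set S := C.diagram.chords with hS
  set D : Fin (2 * C.size) → Fin (2 * C.size) := ⇑C.diagram.perm with hD
  have hDD : ∀ x, D (D x) = x := C.diagram.perm_perm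
  have hlt : ∀ {x}, x ∈ S → x < D x := fun h => lt_perm_of_mem h
  have hinj : ∀ {x y}, D x = D y → x = y := fun h => C.diagram.perm.injective h
  have hne : (S.erase C.root).Nonempty := by
    rw [← Finset.card_pos, Finset.card_erase_of_mem C.root_mem, C.diagram.card_chords]
    omega
  set z := (S.erase C.root).min' hne with hz
  have hzm : z ∈ S.erase C.root := Finset.min'_mem _ _
  set T'' := component D (S.erase C.root) z with hT''
  have hTsub : T'' ⊆ S.erase C.root := component_subset _ _ _
  have hzT : z ∈ T'' := mem_component_self D hzm
  have hTc : Conn D T'' := conn_component hzm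
  have hT''S : T'' ⊆ S := hTsub.trans (Finset.erase_subset _ _)
  have hrootT : C.root ∉ T'' := fun h => (Finset.mem_erase.1 (hTsub h)).1 rfl
  have hncr : ∀ u ∈ T'', ∀ v ∈ S \ T'', v ≠ C.root → ¬ Crosses D u v := by
    intro u hu v hv hvr huv
    rw [Finset.mem_sdiff] at hv
    exact hv.2 (component_closed hu (Finset.mem_erase.2 ⟨hvr, hv.1⟩) huv)
  have hrootT' : C.root ∈ S \ T'' := Finset.mem_sdiff.2 ⟨C.root_mem, hrootT⟩
  -- A walk from the root can return from `T''` only through the root, so the detour may be cut off.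
  have hT'c : Conn D (S \ T'') := by
    refine Conn.of_root hrootT' ?_
    have := C.conn.induction (p := fun u => u ∈ S \ T'' →
      Relation.ReflTransGen (CrossIn D (S \ T'')) C.root u) C.root_mem (fun _ => .refl) (by
        intro u hu v hv ih huv hvT
        by_cases huT : u ∈ T''
        · by_cases hvr : v = C.root
          · rw [hvr]
          · exact absurd huv (hncr u huT v hvT hvr)
        · have hu' := Finset.mem_sdiff.2 ⟨hu, huT⟩
          exact (ih hu').tail ⟨hu', hvT, huv⟩)
    exact fun y hy => this y (Finset.mem_sdiff.1 hy).1 hy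
  -- Otherwise `T''` would be closed under crossings in the connected diagram and contain the root.
  have hstr : ∃ u ∈ T'', Crosses D C.root u := by
    by_contra! hcon
    refine hrootT (C.conn.induction (p := fun u => u ∈ T'') (hT''S hzT) hzT ?_ C.root C.root_mem)
    intro u hu v hv huT huv
    by_contra hvT
    by_cases hvr : v = C.root
    · rw [hvr] at huv
      exact hcon u huT huv.symm
    · exact hncr u huT v (Finset.mem_sdiff.2 ⟨hv, hvT⟩) hvr huv
  -- An endpoint of `T''` under `c` forces its chord to be nested in `c`, as the two do not cross.
  -- Nesting spreads through the connected `T''` to `z`, but `z` is the smallest non-root chord.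
  have hA : ∀ c ∈ S \ T'', c ≠ C.root → ∀ p, (p ∈ T'' ∨ D p ∈ T'') → c < p → ¬ p < D c := by
    intro c hc hcr p hp hcp hpc
    have hcS := (Finset.mem_sdiff.1 hc).1
    have hcT := (Finset.mem_sdiff.1 hc).2
    have hin : ∃ u ∈ T'', c < u ∧ D u < D c := by
      rcases hp with hp | hp
      · refine ⟨p, hp, hcp, ?_⟩
        by_contra h
        have h1 : D c ≠ D p := fun e => hcT (by rw [hinj e]; exact hp)
        exact hncr p hp c hc hcr (.inr ⟨hcp, hpc, lt_of_le_of_ne (not_lt.1 h) h1⟩)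
      · refine ⟨D p, hp, ?_, by rwa [hDD]⟩
        by_contra h
        have h1 : D p ≠ c := fun e => hcT (by rw [← e]; exact hp)
        exact hncr _ hp c hc hcr (.inl ⟨lt_of_le_of_ne (not_lt.1 h) h1, by rwa [hDD],
          by rwa [hDD]⟩)
    obtain ⟨u, hu, hcu⟩ := hin
    have := hTc.induction (p := fun u => c < u ∧ D u < D c) hu hcu (by
      intro u hu v hv ih huv
      have h1 : D v ≠ D c := fun e => hcT (by rw [← hinj e]; exact hv)
      have h2 : v ≠ c := fun e => hcT (by rw [← e]; exact hv)
      have h3 := hncr v hv c hc hcr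
      simp only [Crosses, not_or, not_and, not_lt] at h3
      rcases huv with ⟨a1, a2, a3⟩ | ⟨a1, a2, a3⟩
      · have b1 := ih.1.trans a1
        exact ⟨b1, lt_of_le_of_ne (h3.2 b1 (a2.trans ih.2)) h1⟩
      · have b1 := a3.trans ih.2
        refine ⟨?_, b1⟩
        by_contra b2
        have b3 := lt_of_le_of_ne (not_lt.1 b2) h2
        exact absurd b1 (h3.1 b3 (ih.1.trans a2)).not_gt)
    exact absurd (this z hzT).1 (Finset.min'_le _ _ (Finset.mem_erase.2 ⟨hcr, hcS⟩)).not_gt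
  have hpne : ∀ c ∈ S \ T'', ∀ p, (p ∈ T'' ∨ D p ∈ T'') → p ≠ c ∧ p ≠ D c := by
    intro c hc p hp
    rw [Finset.mem_sdiff] at hc
    have h1 := hlt hc.1
    constructor
    · rintro rfl
      rcases hp with hp | hp
      · exact hc.2 hp
      · have := hlt (hT''S hp)
        rw [hDD] at this
        exact lt_asymm h1 this
    · rintro rfl
      rw [hDD] at hp
      rcases hp with hp | hp
      · have := hlt (hT''S hp)
        rw [hDD] at this
        exact lt_asymm h1 this
      · exact hc.2 hp
  have hA' : ∀ c ∈ S \ T'', c ≠ C.root → ∀ p, (p ∈ T'' ∨ D p ∈ T'') → (p < D c ↔ p < c) := by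
    intro c hc hcr p hp
    refine ⟨fun h => ?_, fun h => h.trans (hlt (Finset.mem_sdiff.1 hc).1)⟩
    by_contra h'
    exact hA c hc hcr p hp (lt_of_le_of_ne (not_lt.1 h') (hpne c hc p hp).1.symm) h
  -- Crossing chords other than the root lie in the same gap of `T''`, and a chord crossing the root
  -- lies in the gap of the second endpoint of the root. Connectedness carries this to the whole
  -- complement.
  have hB : ∀ c ∈ S \ T'', c = C.root ∨
      ∀ p, (p ∈ T'' ∨ D p ∈ T'') → (p < c ↔ p < D C.root) := by
    refine hT'c.induction hrootT' (.inl rfl) fun u hu v hv ih huv => ?_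
    by_cases hvr : v = C.root
    · exact .inl hvr
    refine .inr fun p hp => ?_
    by_cases hur : u = C.root
    · rw [hur] at huv
      rcases huv with ⟨a1, a2, a3⟩ | ⟨a1, _⟩
      · exact ⟨fun h => h.trans a2, fun h => (hA' v hv hvr p hp).1 (h.trans a3)⟩
      · exact absurd a1 (C.root_le v).not_gt
    · rw [← ih.resolve_left hur p hp]
      rcases huv with ⟨a1, a2, a3⟩ | ⟨a1, a2, a3⟩
      · exact ⟨fun h => (hA' u hu hur p hp).1 (h.trans a2), fun h => h.trans a1⟩
      · exact ⟨fun h => h.trans a1, fun h => (hA' v hv hvr p hp).1 (h.trans a2)⟩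
  obtain ⟨B', f', hf'⟩ := exists_emb C (T := S \ T'') Finset.sdiff_subset hT'c
  obtain ⟨B'', f'', hf''⟩ := exists_emb C (T := T'') hT''S hTc
  have hr' : ∀ y, (∃ x, f'.e x = y) ↔ y ∈ S \ T'' ∨ D y ∈ S \ T'' := by
    intro y
    have := Set.ext_iff.1 f'.range_eq y
    rwa [hf'] at this
  have hr'' : ∀ y, (∃ x, f''.e x = y) ↔ y ∈ T'' ∨ D y ∈ T'' := by
    intro y
    have := Set.ext_iff.1 f''.range_eq y
    rwa [hf''] at this
  have hroot : f'.e B'.root = C.root := by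
    obtain ⟨x, hx⟩ := (hr' C.root).2 (.inl hrootT')
    refine le_antisymm ?_ (C.root_le _)
    rw [← hx]
    exact f'.e.le_iff_le.2 (B'.root_le x)
  have hnefg : ∀ x y, f'.e x ≠ f''.e y := by
    intro x y hxy
    have h2 := (hr'' _).1 ⟨y, rfl⟩
    rcases (hr' _).1 ⟨x, rfl⟩ with h1 | h1
    · exact (hpne _ h1 _ h2).1 hxy.symm
    · exact (hpne _ h1 _ h2).2 (by rw [hDD, hxy])
  have hk : ∀ y : Fin (2 * B''.size), y.val <
      (Finset.univ.filter fun y => f''.e y < D C.root).card ↔ f''.e y < D C.root :=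
    lt_card_filter_iff fun x y hxy hy => (f''.e.le_iff_le.2 hxy).trans_lt hy
  obtain ⟨u, hu, hcru⟩ := hstr
  have hru : C.root < u ∧ u < D C.root ∧ D C.root < D u := by
    rcases hcru with h | h
    · exact h
    · exact absurd h.1 (C.root_le u).not_gt
  refine ⟨B', B'', (Finset.univ.filter fun y => f''.e y < D C.root).card,
    ⟨⟨f'.e, f''.e, ⟨f'.comm, f''.comm, hnefg, ?_, ?_, ?_, ?_, ?_⟩, f'.dec, f''.dec⟩⟩⟩
  · intro y
    rw [hr', hr'']
    rcases C.diagram.mem_chords_or y with h | h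
    · by_cases hy : y ∈ T''
      · exact .inr (.inl hy)
      · exact .inl (.inl (Finset.mem_sdiff.2 ⟨h, hy⟩))
    · by_cases hy : D y ∈ T''
      · exact .inr (.inr hy)
      · exact .inl (.inr (Finset.mem_sdiff.2 ⟨h, hy⟩))
  · intro y
    have := hnefg B'.root y
    rw [hroot] at this ⊢
    exact lt_of_le_of_ne (C.root_le _) this
  · intro x y hx
    rw [hk]
    have hy := (hr'' _).1 ⟨y, rfl⟩
    have hx' : f'.e x ≠ C.root := fun h => hx (f'.e.injective (h.trans hroot.symm))
    rcases (hr' _).1 ⟨x, rfl⟩ with h | h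
    · exact (hB _ h).resolve_left hx' _ hy
    · by_cases hxr : D (f'.e x) = C.root
      · rw [← hxr, hDD]
      · rw [← (hB _ h).resolve_left hxr _ hy, ← hA' _ h hxr _ hy, hDD]
  -- The chord `u` of `T''` crossing the root has one endpoint on each side of `D C.root`, which
  -- gives both bounds on `k`.
  · obtain ⟨y, hy⟩ := (hr'' u).2 (.inl hu)
    have := (hk y).2 (by rw [hy]; exact hru.2.1)
    omega
  · obtain ⟨y, hy⟩ := (hr'' (D u)).2 (.inr (by rwa [hDD]))
    have := mt (hk y).1 (by rw [hy]; exact hru.2.2.not_gt)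
    have := y.2
    omega

end DecDiagram
-- Labels, terminal chords, `ν` and weights as functions of points
namespace DecDiagram

variable {Δ : Set ℕ+}

/-- The label of the chord with smaller endpoint `x`. -/
noncomputable def labAt (C : DecDiagram Δ) (x : Fin (2 * C.size)) : ℕ :=
  label C.diagram.perm C.diagram.chords x

/-- The set of smaller endpoints of terminal chords. -/
noncomputable def terPts (C : DecDiagram Δ) : Finset (Fin (2 * C.size)) :=
  C.ter.map (Function.Embedding.subtype _)

/-- The smaller endpoint of the base chord. -/
noncomputable def basePt (C : DecDiagram Δ) : Fin (2 * C.size) := C.baseChord.1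

theorem mem_terPts {C : DecDiagram Δ} {x : Fin (2 * C.size)} : x ∈ C.terPts ↔
    x ∈ C.diagram.chords ∧ ∀ e ∈ C.diagram.chords, x < e → ¬ Crosses C.diagram.perm x e := by
  simp only [terPts, Finset.mem_map, ter, Finset.mem_filter, Finset.mem_univ, true_and,
    Function.Embedding.subtype_apply]
  constructor
  · rintro ⟨c, hc, rfl⟩
    exact ⟨c.2, fun e he hlt => hc ⟨e, he⟩ hlt⟩
  · rintro ⟨hx, h⟩
    exact ⟨⟨x, hx⟩, fun e hlt => h e.1 e.2 hlt, rfl⟩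

theorem terPts_subset (C : DecDiagram Δ) : C.terPts ⊆ C.diagram.chords :=
  fun _ h => (mem_terPts.1 h).1

theorem basePt_mem_chords (C : DecDiagram Δ) : C.basePt ∈ C.diagram.chords := C.baseChord.2

theorem baseChord_spec (C : DecDiagram Δ) :
    C.baseChord ∈ C.ter ∧ ∀ c ∈ C.ter, C.lab C.baseChord ≤ C.lab c :=
  (Finset.exists_min_image C.ter C.lab C.ter_nonempty).choose_spec

theorem basePt_mem (C : DecDiagram Δ) : C.basePt ∈ C.terPts :=
  Finset.mem_map_of_mem _ C.baseChord_spec.1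

theorem labAt_basePt (C : DecDiagram Δ) : C.labAt C.basePt = C.b := rfl

theorem b_le_labAt (C : DecDiagram Δ) {x : Fin (2 * C.size)} (hx : x ∈ C.terPts) :
    C.b ≤ C.labAt x := by
  obtain ⟨c, hc, rfl⟩ := Finset.mem_map.1 hx
  exact C.baseChord_spec.2 c hc

theorem labAt_injOn (C : DecDiagram Δ) {x y : Fin (2 * C.size)} (hx : x ∈ C.diagram.chords)
    (h : C.labAt x = C.labAt y) : x = y :=
  (List.idxOf_inj (mem_intersectionOrder.2 hx)).1 (Nat.succ_injective h)

theorem labAt_pos (C : DecDiagram Δ) (x : Fin (2 * C.size)) : 1 ≤ C.labAt x :=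
  Nat.le_add_left _ _

theorem b_pos (C : DecDiagram Δ) : 1 ≤ C.b := C.labAt_pos C.basePt

theorem labAt_le (C : DecDiagram Δ) {x : Fin (2 * C.size)} (hx : x ∈ C.diagram.chords) :
    C.labAt x ≤ C.size := by
  have := List.idxOf_lt_length_of_mem (mem_intersectionOrder (D := C.diagram.perm).2 hx)
  rwa [length_intersectionOrder, C.diagram.card_chords] at this

theorem basePt_eq {C : DecDiagram Δ} {x : Fin (2 * C.size)} (hx : x ∈ C.terPts)
    (h : ∀ y ∈ C.terPts, C.labAt x ≤ C.labAt y) : C.basePt = x :=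
  C.labAt_injOn C.basePt_mem_chords (le_antisymm (C.b_le_labAt hx) (h _ C.basePt_mem))

theorem intersectionOrder_chords (C : DecDiagram Δ) :
    intersectionOrder C.diagram.perm C.diagram.chords =
      C.root :: intersectionOrder C.diagram.perm (C.diagram.chords.erase C.root) := by
  rw [C.conn.intersectionOrder_eq C.chords_nonempty, min'_chords]

theorem labAt_root (C : DecDiagram Δ) : C.labAt C.root = 1 := by
  rw [labAt, label, intersectionOrder_chords, List.idxOf_cons_self]

theorem chords_eq_singleton {C : DecDiagram Δ} (h : C.size = 1) : C.diagram.chords = {C.root} := by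
  have := C.diagram.card_chords
  obtain ⟨x, hx⟩ := Finset.card_eq_one.1 (this.trans h)
  have hr := C.root_mem
  rw [hx, Finset.mem_singleton] at hr
  rw [hx, hr]

theorem terPts_eq_singleton {C : DecDiagram Δ} (h : C.size = 1) : C.terPts = {C.root} := by
  have h1 := C.terPts_subset
  rw [chords_eq_singleton h] at h1
  exact (Finset.Nonempty.subset_singleton_iff ⟨_, C.basePt_mem⟩).1 h1

theorem basePt_eq_root {C : DecDiagram Δ} (h : C.size = 1) : C.basePt = C.root := by
  have := C.basePt_mem
  rwa [terPts_eq_singleton h, Finset.mem_singleton] at this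

theorem b_eq_one {C : DecDiagram Δ} (h : C.size = 1) : C.b = 1 := by
  rw [← labAt_basePt, basePt_eq_root h, labAt_root]

/-- The label of the terminal chord preceding the chord with smaller endpoint `x`. -/
noncomputable def prevLab (C : DecDiagram Δ) (x : Fin (2 * C.size)) : ℕ :=
  (C.terPts.filter fun e => C.labAt e < C.labAt x).sup C.labAt

theorem prevTerLab_eq (C : DecDiagram Δ) (c : C.Chord) : C.prevTerLab c = C.prevLab c := by
  unfold prevTerLab prevLab terPts
  rw [Finset.filter_map, Finset.sup_map]
  congr 1

theorem prevLab_eq {C : DecDiagram Δ} {x e : Fin (2 * C.size)} (he : e ∈ C.terPts)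
    (hlt : C.labAt e < C.labAt x)
    (h : ∀ y ∈ C.terPts, C.labAt y < C.labAt x → C.labAt y ≤ C.labAt e) :
    C.prevLab x = C.labAt e := by
  refine le_antisymm (Finset.sup_le fun y hy => ?_)
    (Finset.le_sup (f := C.labAt) (Finset.mem_filter.2 ⟨he, hlt⟩))
  rw [Finset.mem_filter] at hy
  exact h y hy.1 hy.2

theorem exists_prevLab {C : DecDiagram Δ} {x : Fin (2 * C.size)} (hx : x ∈ C.terPts)
    (hb : x ≠ C.basePt) : ∃ e ∈ C.terPts, C.labAt e < C.labAt x ∧ C.prevLab x = C.labAt e ∧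
      ∀ y ∈ C.terPts, C.labAt y < C.labAt x → C.labAt y ≤ C.labAt e := by
  have hne : (C.terPts.filter fun e => C.labAt e < C.labAt x).Nonempty :=
    ⟨C.basePt, Finset.mem_filter.2 ⟨C.basePt_mem, lt_of_le_of_ne (C.b_le_labAt hx)
      fun h => hb (C.labAt_injOn C.basePt_mem_chords h).symm⟩⟩
  obtain ⟨e, he, hs⟩ := Finset.exists_mem_eq_sup _ hne C.labAt
  rw [Finset.mem_filter] at he
  refine ⟨e, he.1, he.2, hs, fun y hy hlt => ?_⟩
  rw [← hs]
  exact Finset.le_sup (f := C.labAt) (Finset.mem_filter.2 ⟨hy, hlt⟩)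

/-- The value of `ν` at the chord with smaller endpoint `x`. -/
noncomputable def nuAt (C : DecDiagram Δ) (x : Fin (2 * C.size)) : ℕ := C.tree.nu x

theorem leaves_tree (C : DecDiagram Δ) : C.tree.leaves.Perm C.diagram.chords.toList :=
  leaves_insertionTree_perm _ _ _

theorem mem_leaves_tree {C : DecDiagram Δ} {x : Fin (2 * C.size)} :
    x ∈ C.tree.leaves ↔ x ∈ C.diagram.chords := by
  rw [C.leaves_tree.mem_iff, Finset.mem_toList]

theorem nodup_leaves_tree (C : DecDiagram Δ) : C.tree.leaves.Nodup :=
  C.leaves_tree.nodup_iff.2 (Finset.nodup_toList _)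

theorem numEdges_tree (C : DecDiagram Δ) : C.tree.numEdges = 2 * C.size - 1 := by
  have h := C.tree.numEdges_add_one
  rw [C.leaves_tree.length_eq, Finset.length_toList, C.diagram.card_chords] at h
  omega

theorem nuAt_eq_zero {C : DecDiagram Δ} (h : C.size = 1) (x : Fin (2 * C.size)) :
    C.nuAt x = 0 := by
  have h1 := C.tree.numEdges_add_one
  have h2 := C.numEdges_tree
  unfold nuAt
  cases hT : C.tree with
  | leaf y => rfl
  | node l r =>
    rw [hT] at h2
    have h3 := l.numEdges_add_one
    have h4 := List.length_pos_of_mem l.rightmost_mem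
    simp only [PlaneTree.numEdges] at h2
    omega

theorem norm_eq (C : DecDiagram Δ) : C.norm = ∑ x ∈ C.diagram.chords, (C.decAt x : ℕ) := by
  refine Eq.trans ?_ (Finset.sum_coe_sort C.diagram.chords fun x => (C.decAt x : ℕ))
  exact Finset.sum_congr rfl fun c _ => by rw [decAt_coe]

section Coefficients

variable {R : Type*} [CommRing R]

theorem aHat_eq (C : DecDiagram Δ) (a : ℕ+ → ℕ → R) : C.aHat a =
    (∏ x ∈ C.terPts.erase C.basePt, a (C.decAt x) (C.labAt x - C.prevLab x)) *
      ∏ x ∈ C.diagram.chords \ C.terPts, a (C.decAt x) 0 := by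
  classical
  have h1 : C.terPts.erase C.basePt =
      (C.ter.erase C.baseChord).map (Function.Embedding.subtype _) :=
    (Finset.map_erase (Function.Embedding.subtype _) C.ter C.baseChord).symm
  have h2 : C.diagram.chords \ C.terPts = C.terᶜ.map (Function.Embedding.subtype _) := by
    ext x
    simp only [terPts, Finset.mem_sdiff, Finset.mem_map, Finset.mem_compl,
      Function.Embedding.subtype_apply]
    constructor
    · rintro ⟨h1, h2⟩
      exact ⟨⟨x, h1⟩, fun h => h2 ⟨_, h, rfl⟩, rfl⟩
    · rintro ⟨c, hc, rfl⟩
      refine ⟨c.2, ?_⟩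
      rintro ⟨c', hc', h⟩
      exact hc (Subtype.ext h ▸ hc')
  rw [h1, h2, Finset.prod_map, Finset.prod_map, aHat]
  congr 1
  · refine Finset.prod_congr (by congr) fun c _ => ?_
    rw [prevTerLab_eq]
    simp only [Function.Embedding.subtype_apply, decAt_coe]
    rfl
  · refine Finset.prod_congr (by congr) fun c _ => ?_
    simp only [Function.Embedding.subtype_apply, decAt_coe]

variable [BinomialRing R]

/-- The binomial `binom(d s + ν - 2, ν)`. -/
noncomputable def factor (s : R) (d : ℕ+) (ν : ℕ) : R :=
  Ring.choose (((d : ℕ) : R) * s + (ν : R) - 2) ν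

/-- This is the absorption identity `(ν+1) binom(x, ν+1) = x binom(x-1, ν)` at `x = d s + ν - 1`.
The multiplicity `ν + 1` is the number of edges owned by a leaf. -/
theorem factor_succ (s : R) (d : ℕ+) (ν : ℕ) :
    ((ν : R) + 1) * factor s d (ν + 1) = (((d : ℕ) : R) * s + ν - 1) * factor s d ν := by
  have h := Ring.choose_smul_choose (((d : ℕ) : R) * s + ((ν + 1 : ℕ) : R) - 2) (n := ν + 1)
    (k := 1) (by omega)
  rw [Nat.choose_one_right, Ring.choose_one_right, nsmul_eq_mul, Nat.add_sub_cancel] at h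
  unfold factor
  push_cast at h ⊢
  rw [h]
  congr 1
  · ring
  · congr 1
    ring

theorem weight_eq (C : DecDiagram Δ) (s : R) :
    C.weight s = ∏ x ∈ C.diagram.chords, factor s (C.decAt x) (C.nuAt x) := by
  refine Eq.trans ?_ (Finset.prod_coe_sort C.diagram.chords fun x =>
    factor s (C.decAt x) (C.nuAt x))
  refine Finset.prod_congr rfl fun c _ => ?_
  rw [decAt_coe]
  rfl

theorem weightHat_eq (C : DecDiagram Δ) (s : R) : C.weightHat s =
    ∏ x ∈ C.diagram.chords.erase C.basePt, factor s (C.decAt x) (C.nuAt x) := by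
  classical
  have h1 : C.diagram.chords.erase C.basePt =
      ((Finset.univ : Finset C.Chord).erase C.baseChord).map (Function.Embedding.subtype _) := by
    rw [Finset.map_erase]
    congr 1
    ext x
    simp
  rw [weightHat, h1, Finset.prod_map]
  refine Finset.prod_congr (by congr) fun c _ => ?_
  rw [Function.Embedding.subtype_apply, decAt_coe]
  rfl

end Coefficients

end DecDiagram

theorem _root_.List.idxOf_map_of_injective {α β : Type*} [DecidableEq α] [DecidableEq β] {f : α → β}
    (hf : Function.Injective f) (L : List α) (x : α) : (L.map f).idxOf (f x) = L.idxOf x := by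
  induction L with
  | nil => rfl
  | cons y L ih =>
    by_cases h : y = x
    · subst h; simp
    · rw [List.map_cons, List.idxOf_cons_ne _ h, List.idxOf_cons_ne _ (fun e => h (hf e)), ih]

/-! ### Labels, monomials and weights under the root share decomposition -/

namespace DecDiagram

variable {Δ : Set ℕ+}

namespace Decomp

variable {C C' C'' : DecDiagram Δ} {k : ℕ}

theorem sum_chords {M : Type*} [AddCommMonoid M] (h : Decomp C C' C'' k)
    (f : Fin (2 * C.size) → M) : ∑ x ∈ C.diagram.chords, f x =
      ∑ x ∈ C'.diagram.chords, f (h.l x) + ∑ x ∈ C''.diagram.chords, f (h.r x) := by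
  rw [h.chords_eq, Finset.sum_union h.disjoint, Finset.sum_map, Finset.sum_map]
  rfl

theorem norm_eq (h : Decomp C C' C'' k) : C.norm = C'.norm + C''.norm := by
  simp only [DecDiagram.norm_eq, h.sum_chords, h.dec_left, h.dec_right]

theorem intersectionOrder_eq (h : Decomp C C' C'' k) :
    intersectionOrder C.diagram.perm C.diagram.chords = C.root ::
      ((intersectionOrder C''.diagram.perm C''.diagram.chords).map h.r ++
        (intersectionOrder C'.diagram.perm (C'.diagram.chords.erase C'.root)).map h.l) := by
  have h1 := intersectionOrder_erase_min (D := C.diagram.perm) C.chords_nonempty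
  rw [h.firstComponent_eq, h.sdiff_eq, min'_chords] at h1
  rw [intersectionOrder_chords, h1, ← h.l_root, erase_map, intersectionOrder_map h.splice.comm_left,
    intersectionOrder_map h.splice.comm_right]

theorem labAt_r (h : Decomp C C' C'' k) {y : Fin (2 * C''.size)} (hy : y ∈ C''.diagram.chords) :
    C.labAt (h.r y) = C''.labAt y + 1 := by
  have hne : C.root ≠ h.r y := by rw [← h.l_root]; exact h.splice.ne _ _
  rw [labAt, label, h.intersectionOrder_eq, List.idxOf_cons_ne _ hne, List.idxOf_append_of_mem
    (List.mem_map_of_mem (mem_intersectionOrder.2 hy)),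
    List.idxOf_map_of_injective h.r.injective]
  rfl

/-- The chords of `C''` are listed right after the root. The shift is `|C''|`, not `|C''| + 1`,
because the root is already counted in the label within `C'`. -/
theorem labAt_l (h : Decomp C C' C'' k) {x : Fin (2 * C'.size)} (hx : x ≠ C'.root) :
    C.labAt (h.l x) = C'.labAt x + C''.size := by
  have hne : C.root ≠ h.l x := by
    rw [← h.l_root]; exact fun e => hx (h.l.injective e).symm
  have hnm : h.l x ∉ (intersectionOrder C''.diagram.perm C''.diagram.chords).map h.r := by
    intro hm
    obtain ⟨y, _, hy⟩ := List.mem_map.1 hm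
    exact h.splice.ne _ _ hy.symm
  rw [labAt, label, h.intersectionOrder_eq, List.idxOf_cons_ne _ hne,
    List.idxOf_append_of_notMem hnm, List.idxOf_map_of_injective h.l.injective, List.length_map,
    length_intersectionOrder, C''.diagram.card_chords, labAt, label, intersectionOrder_chords,
    List.idxOf_cons_ne _ hx.symm]
  omega

theorem crosses_r (h : Decomp C C' C'' k) {x y : Fin (2 * C''.size)} :
    Crosses C.diagram.perm (h.r x) (h.r y) ↔ Crosses C''.diagram.perm x y :=
  crosses_map h.splice.comm_right

theorem crosses_l (h : Decomp C C' C'' k) {x y : Fin (2 * C'.size)} :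
    Crosses C.diagram.perm (h.l x) (h.l y) ↔ Crosses C'.diagram.perm x y :=
  crosses_map h.splice.comm_left

theorem r_mem_terPts (h : Decomp C C' C'' k) {y : Fin (2 * C''.size)} :
    h.r y ∈ C.terPts ↔ y ∈ C''.terPts := by
  rw [mem_terPts, mem_terPts, h.r_mem]
  refine and_congr_right fun hy => ⟨fun H e he hlt hc => ?_, fun H e he hlt hc => ?_⟩
  · exact H (h.r e) (h.r_mem.2 he) (h.r.lt_iff_lt.2 hlt) (h.crosses_r.2 hc)
  · rcases h.splice.cover e with ⟨x, rfl⟩ | ⟨z, rfl⟩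
    · by_cases hx : x = C'.root
      · rw [hx] at hlt
        exact hlt.not_gt (h.splice.root_lt _)
      · exact h.splice.not_crosses (h.l_mem.1 he) hx hc.symm
    · exact H z (h.r_mem.1 he) (h.r.lt_iff_lt.1 hlt) (h.crosses_r.1 hc)

/-- The root crosses a later chord of `C''`, hence is not terminal; the other chords of `C'` meet no
new chord. -/
theorem l_mem_terPts (h : Decomp C C' C'' k) {x : Fin (2 * C'.size)} :
    h.l x ∈ C.terPts ↔ x ≠ C'.root ∧ x ∈ C'.terPts := by
  rw [mem_terPts, mem_terPts, h.l_mem]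
  constructor
  · rintro ⟨hx, H⟩
    refine ⟨?_, hx, fun e he hlt hc =>
      H (h.l e) (h.l_mem.2 he) (h.l.lt_iff_lt.2 hlt) (h.crosses_l.2 hc)⟩
    rintro rfl
    obtain ⟨y, hy, hc⟩ := h.splice.exists_crosses_root
    exact H _ (h.r_mem.2 hy) (h.splice.root_lt y) hc
  · rintro ⟨hne, hx, H⟩
    refine ⟨hx, fun e he hlt hc => ?_⟩
    rcases h.splice.cover e with ⟨z, rfl⟩ | ⟨y, rfl⟩
    · exact H z (h.l_mem.1 he) (h.l.lt_iff_lt.1 hlt) (h.crosses_l.1 hc)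
    · exact h.splice.not_crosses hx hne hc

theorem root_notMem_terPts (h : Decomp C C' C'' k) : C.root ∉ C.terPts := by
  rw [← h.l_root, h.l_mem_terPts]
  exact fun H => H.1 rfl

theorem forall_terPts (h : Decomp C C' C'' k) {p : Fin (2 * C.size) → Prop}
    (hl : ∀ x ∈ C'.terPts, x ≠ C'.root → p (h.l x)) (hr : ∀ y ∈ C''.terPts, p (h.r y)) :
    ∀ z ∈ C.terPts, p z := by
  intro z hz
  rcases h.splice.cover z with ⟨x, rfl⟩ | ⟨y, rfl⟩
  · exact hl x (h.l_mem_terPts.1 hz).2 (h.l_mem_terPts.1 hz).1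
  · exact hr y (h.r_mem_terPts.1 hz)

theorem basePt_eq (h : Decomp C C' C'' k) : C.basePt = h.r C''.basePt := by
  refine DecDiagram.basePt_eq (h.r_mem_terPts.2 C''.basePt_mem) (h.forall_terPts ?_ ?_)
  · intro x hx hne
    rw [h.labAt_r C''.basePt_mem_chords, h.labAt_l hne]
    have := C''.labAt_le C''.basePt_mem_chords
    have := C'.labAt_pos x
    omega
  · intro y hy
    rw [h.labAt_r C''.basePt_mem_chords, h.labAt_r (C''.terPts_subset hy)]
    exact Nat.succ_le_succ (C''.b_le_labAt hy)

theorem b_eq (h : Decomp C C' C'' k) : C.b = C''.b + 1 := by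
  rw [← labAt_basePt, h.basePt_eq, h.labAt_r C''.basePt_mem_chords, labAt_basePt]

end Decomp

theorem eq_root_of_root_mem_terPts {C : DecDiagram Δ} (h : C.root ∈ C.terPts) : C.size = 1 := by
  by_contra hs
  have := C.size_pos
  obtain ⟨C', C'', k, ⟨hd⟩⟩ := exists_decomp C (by omega)
  exact hd.root_notMem_terPts h

/-- The last chord is that of `C'`, or that of `C''` if `C'` is a single chord. The result locates
the terminal chord preceding the base chord of `C'` inside `C`. -/
theorem exists_last (C : DecDiagram Δ) : ∃ x ∈ C.terPts, C.labAt x = C.size := by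
  suffices H : ∀ (n : ℕ) (C : DecDiagram Δ), C.size = n → ∃ x ∈ C.terPts, C.labAt x = C.size from
    H _ C rfl
  intro n
  induction n using Nat.strong_induction_on with
  | _ n ih =>
    rintro C rfl
    by_cases hs : C.size = 1
    · exact ⟨C.root, by rw [terPts_eq_singleton hs]; simp, by rw [labAt_root, hs]⟩
    have := C.size_pos
    obtain ⟨C', C'', k, ⟨hd⟩⟩ := exists_decomp C (by omega)
    have h1 := hd.size_eq
    have h2 := C'.size_pos
    have h3 := C''.size_pos
    by_cases hs' : C'.size = 1
    · obtain ⟨y, hy, hl⟩ := ih C''.size (by omega) C'' rfl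
      exact ⟨hd.r y, hd.r_mem_terPts.2 hy, by rw [hd.labAt_r (C''.terPts_subset hy)]; omega⟩
    · obtain ⟨x, hx, hl⟩ := ih C'.size (by omega) C' rfl
      have hne : x ≠ C'.root := by
        rintro rfl
        rw [labAt_root] at hl
        omega
      exact ⟨hd.l x, hd.l_mem_terPts.2 ⟨hne, hx⟩, by rw [hd.labAt_l hne]; omega⟩

namespace Decomp

variable {C C' C'' : DecDiagram Δ} {k : ℕ}

theorem prevLab_r (h : Decomp C C' C'' k) {y : Fin (2 * C''.size)} (hy : y ∈ C''.terPts)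
    (hb : y ≠ C''.basePt) : C.prevLab (h.r y) = C''.prevLab y + 1 := by
  obtain ⟨e, he, hlt, hp, hmax⟩ := exists_prevLab hy hb
  have hy' := C''.terPts_subset hy
  have he' := C''.terPts_subset he
  rw [hp, ← h.labAt_r he']
  refine prevLab_eq (h.r_mem_terPts.2 he) ?_ (h.forall_terPts ?_ ?_)
  · rw [h.labAt_r hy', h.labAt_r he']; omega
  · intro x _ hne hlt'
    rw [h.labAt_l hne, h.labAt_r hy'] at hlt'
    have := C''.labAt_le hy'
    have := C'.labAt_pos x
    omega
  · intro z hz hlt'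
    rw [h.labAt_r hy', h.labAt_r (C''.terPts_subset hz)] at hlt'
    rw [h.labAt_r he', h.labAt_r (C''.terPts_subset hz)]
    exact Nat.succ_le_succ (hmax z hz (by omega))

theorem prevLab_l (h : Decomp C C' C'' k) {x : Fin (2 * C'.size)} (hx : x ∈ C'.terPts)
    (hr : C'.root ∉ C'.terPts) (hb : x ≠ C'.basePt) :
    C.prevLab (h.l x) = C'.prevLab x + C''.size := by
  obtain ⟨e, he, hlt, hp, hmax⟩ := exists_prevLab hx hb
  have hxr : x ≠ C'.root := fun e => hr (e ▸ hx)
  have her : e ≠ C'.root := fun h => hr (h ▸ he)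
  rw [hp, ← h.labAt_l her]
  refine prevLab_eq (h.l_mem_terPts.2 ⟨her, he⟩) ?_ (h.forall_terPts ?_ ?_)
  · rw [h.labAt_l hxr, h.labAt_l her]; omega
  · intro z hz hne hlt'
    rw [h.labAt_l hne, h.labAt_l hxr] at hlt'
    rw [h.labAt_l hne, h.labAt_l her]
    have := hmax z hz (by omega)
    omega
  · intro z hz _
    rw [h.labAt_l her, h.labAt_r (C''.terPts_subset hz)]
    have := C''.labAt_le (C''.terPts_subset hz)
    have := C'.labAt_pos e
    omega

/-- The predecessor is the last chord of `C''`, so the label difference becomes `b(C') + |C''| -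
(|C''| + 1) = b(C') - 1`. -/
theorem prevLab_l_basePt (h : Decomp C C' C'' k) (hr : C'.root ∉ C'.terPts) :
    C.prevLab (h.l C'.basePt) = C''.size + 1 := by
  obtain ⟨e, he, hl⟩ := C''.exists_last
  have he' := C''.terPts_subset he
  have hbr : C'.basePt ≠ C'.root := fun e => hr (e ▸ C'.basePt_mem)
  have hb1 : C'.labAt C'.basePt ≠ 1 := by
    rw [← C'.labAt_root]
    exact fun e => hbr (C'.labAt_injOn C'.basePt_mem_chords e)
  have := C'.labAt_pos C'.basePt
  rw [← hl, ← h.labAt_r he']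
  refine prevLab_eq (h.r_mem_terPts.2 he) ?_ (h.forall_terPts ?_ ?_)
  · rw [h.labAt_r he', h.labAt_l hbr, hl]
    omega
  · intro x hx hne hlt
    rw [h.labAt_l hne, h.labAt_l hbr, labAt_basePt] at hlt
    have := C'.b_le_labAt hx
    omega
  · intro z hz _
    rw [h.labAt_r he', h.labAt_r (C''.terPts_subset hz), hl]
    have := C''.labAt_le (C''.terPts_subset hz)
    omega

theorem terPts_eq (h : Decomp C C' C'' k) : C.terPts =
    (C'.terPts.erase C'.root).map h.l.toEmbedding ∪ C''.terPts.map h.r.toEmbedding := by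
  ext z
  rw [Finset.mem_union, Finset.mem_map, Finset.mem_map]
  constructor
  · revert z
    exact h.forall_terPts
      (fun x hx hne => .inl ⟨x, Finset.mem_erase.2 ⟨hne, hx⟩, rfl⟩) (fun y hy => .inr ⟨y, hy, rfl⟩)
  · rintro (⟨x, hx, rfl⟩ | ⟨y, hy, rfl⟩)
    · exact h.l_mem_terPts.2 (Finset.mem_erase.1 hx)
    · exact h.r_mem_terPts.2 hy

theorem disjoint_map (h : Decomp C C' C'' k) (S : Finset (Fin (2 * C'.size)))
    (T : Finset (Fin (2 * C''.size))) :
    Disjoint (S.map h.l.toEmbedding) (T.map h.r.toEmbedding) := by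
  rw [Finset.disjoint_left]
  intro z hz hz'
  obtain ⟨x, _, rfl⟩ := Finset.mem_map.1 hz
  obtain ⟨y, _, hy⟩ := Finset.mem_map.1 hz'
  exact h.splice.ne x y hy.symm

theorem erase_r (h : Decomp C C' C'' k) (S : Finset (Fin (2 * C'.size)))
    (T : Finset (Fin (2 * C''.size))) (y : Fin (2 * C''.size)) :
    (S.map h.l.toEmbedding ∪ T.map h.r.toEmbedding).erase (h.r y) =
      S.map h.l.toEmbedding ∪ (T.erase y).map h.r.toEmbedding := by
  rw [Finset.erase_union_distrib, erase_map, Finset.erase_eq_of_notMem]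
  intro hm
  obtain ⟨x, _, hx⟩ := Finset.mem_map.1 hm
  exact h.splice.ne x y hx

theorem chords_sdiff_terPts (h : Decomp C C' C'' k) : C.diagram.chords \ C.terPts =
    (C'.diagram.chords \ C'.terPts.erase C'.root).map h.l.toEmbedding ∪
      (C''.diagram.chords \ C''.terPts).map h.r.toEmbedding := by
  ext z
  rw [Finset.mem_sdiff, Finset.mem_union, Finset.mem_map, Finset.mem_map]
  constructor
  · rintro ⟨h1, h2⟩
    rcases h.splice.cover z with ⟨x, rfl⟩ | ⟨y, rfl⟩
    · exact .inl ⟨x, Finset.mem_sdiff.2 ⟨h.l_mem.1 h1,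
        fun hx => h2 (h.l_mem_terPts.2 (Finset.mem_erase.1 hx))⟩, rfl⟩
    · exact .inr ⟨y, Finset.mem_sdiff.2 ⟨h.r_mem.1 h1, fun hy => h2 (h.r_mem_terPts.2 hy)⟩, rfl⟩
  · rintro (⟨x, hx, rfl⟩ | ⟨y, hy, rfl⟩)
    · rw [Finset.mem_sdiff] at hx
      exact ⟨h.l_mem.2 hx.1, fun H => hx.2 (Finset.mem_erase.2 (h.l_mem_terPts.1 H))⟩
    · rw [Finset.mem_sdiff] at hy
      exact ⟨h.r_mem.2 hy.1, fun H => hy.2 (h.r_mem_terPts.1 H)⟩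

section Coefficients

variable {R : Type*} [CommRing R]

/-- All factors of `C'` and `C''` survive because label differences are shift invariant; the base
chord of `C'`, no longer a base chord, adds the last factor. -/
theorem aHat_eq (h : Decomp C C' C'' k) (a : ℕ+ → ℕ → R) :
    C.aHat a = C''.aHat a * (C'.aHat a * a (C'.decAt C'.basePt) (C'.b - 1)) := by
  have hr1 : ∏ y ∈ C''.terPts.erase C''.basePt, a (C.decAt (h.r y))
      (C.labAt (h.r y) - C.prevLab (h.r y)) = ∏ y ∈ C''.terPts.erase C''.basePt,
        a (C''.decAt y) (C''.labAt y - C''.prevLab y) := by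
    refine Finset.prod_congr rfl fun y hy => ?_
    rw [Finset.mem_erase] at hy
    rw [h.dec_right, h.labAt_r (C''.terPts_subset hy.2), h.prevLab_r hy.2 hy.1,
      Nat.add_sub_add_right]
  have key : (∏ x ∈ C'.terPts.erase C'.root, a (C.decAt (h.l x))
        (C.labAt (h.l x) - C.prevLab (h.l x))) *
      (∏ x ∈ C'.diagram.chords \ C'.terPts.erase C'.root, a (C'.decAt x) 0) =
      C'.aHat a * a (C'.decAt C'.basePt) (C'.b - 1) := by
    rw [DecDiagram.aHat_eq C']
    -- For a single chord the added factor arises differently: the root turns non-terminal and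
    -- contributes `a_{d,0}`, which agrees since `b(C') = 1`.
    by_cases hs : C'.size = 1
    · rw [terPts_eq_singleton hs, chords_eq_singleton hs, basePt_eq_root hs, b_eq_one hs]
      simp
    · have hr : C'.root ∉ C'.terPts := fun H => hs (eq_root_of_root_mem_terPts H)
      rw [Finset.erase_eq_of_notMem hr, ← Finset.mul_prod_erase _ _ C'.basePt_mem]
      have hbr : C'.basePt ≠ C'.root := fun e => hr (e ▸ C'.basePt_mem)
      have h2 : ∏ x ∈ C'.terPts.erase C'.basePt, a (C.decAt (h.l x))
          (C.labAt (h.l x) - C.prevLab (h.l x)) = ∏ x ∈ C'.terPts.erase C'.basePt,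
            a (C'.decAt x) (C'.labAt x - C'.prevLab x) := by
        refine Finset.prod_congr rfl fun x hx => ?_
        rw [Finset.mem_erase] at hx
        rw [h.dec_left, h.labAt_l (fun e => hr (e ▸ hx.2)), h.prevLab_l hx.2 hr hx.1,
          Nat.add_sub_add_right]
      rw [h2, h.dec_left, h.labAt_l hbr, h.prevLab_l_basePt hr, labAt_basePt, add_comm C'.b,
        Nat.add_sub_add_left]
      ring
  rw [DecDiagram.aHat_eq C, h.basePt_eq, h.chords_sdiff_terPts, h.terPts_eq, h.erase_r,
    Finset.prod_union (h.disjoint_map _ _), Finset.prod_union (h.disjoint_map _ _)]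
  simp only [Finset.prod_map, RelEmbedding.coe_toEmbedding, h.dec_left, h.dec_right] at key hr1 ⊢
  rw [← key, DecDiagram.aHat_eq C'', hr1]
  ring

end Coefficients

theorem tree_eq (h : Decomp C C' C'' k) :
    C.tree = (C'.tree.map h.l).insertAt k (C''.tree.map h.r) := by
  unfold tree
  rw [insertionTree_eq_insertAt C.diagram.perm C.chords_nonempty (h.firstComponent_eq _) h.sdiff_eq
    (Finset.map_nonempty.2 C''.chords_nonempty) (Finset.map_nonempty.2 C'.chords_nonempty),
    insertionTree_map h.splice.comm_left, insertionTree_map h.splice.comm_right,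
    h.insertionPlace_eq]

theorem nuAt_l (h : Decomp C C' C'' k) {x : Fin (2 * C'.size)} (hx : x ∈ C'.diagram.chords) :
    C.nuAt (h.l x) = C'.nuAt x := by
  unfold nuAt
  rw [h.tree_eq, PlaneTree.nu_insertAt_left, PlaneTree.nu_map h.l.injective]
  · rw [PlaneTree.leaves_map]
    exact List.mem_map_of_mem (mem_leaves_tree.2 hx)
  · rw [PlaneTree.leaves_map, List.mem_map]
    rintro ⟨y, _, hy⟩
    exact h.splice.ne _ _ hy.symm

theorem nuAt_r (h : Decomp C C' C'' k) {y : Fin (2 * C''.size)} (hy : y ∈ C''.diagram.chords) :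
    C.nuAt (h.r y) = C''.nuAt y + if C''.tree.owner k = y then 1 else 0 := by
  unfold nuAt
  rw [h.tree_eq, PlaneTree.nu_insertAt_right, PlaneTree.nu_map h.r.injective,
    PlaneTree.owner_map]
  · congr 1
    simp only [h.r.injective.eq_iff]
  · rw [PlaneTree.leaves_map]
    exact C''.nodup_leaves_tree.map h.r.injective
  · rw [PlaneTree.leaves_map]
    exact List.mem_map_of_mem (mem_leaves_tree.2 hy)
  · rw [PlaneTree.leaves_map, List.mem_map]
    rintro ⟨x, _, hx⟩
    exact h.splice.ne _ _ hx

section Coefficients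

variable {R : Type*} [CommRing R] [BinomialRing R]

theorem weight_eq (h : Decomp C C' C'' k) (s : R) : C.weight s = C'.weight s *
    ∏ y ∈ C''.diagram.chords,
      factor s (C''.decAt y) (C''.nuAt y + if C''.tree.owner k = y then 1 else 0) := by
  rw [DecDiagram.weight_eq, DecDiagram.weight_eq, h.chords_eq,
    Finset.prod_union h.disjoint, Finset.prod_map, Finset.prod_map]
  congr 1
  · refine Finset.prod_congr rfl fun x hx => ?_
    rw [RelEmbedding.coe_toEmbedding, h.dec_left, h.nuAt_l hx]
  · refine Finset.prod_congr rfl fun x hx => ?_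
    rw [RelEmbedding.coe_toEmbedding, h.dec_right, h.nuAt_r hx]

theorem weightHat_eq (h : Decomp C C' C'' k) (s : R) : C.weightHat s = C'.weight s *
    ∏ y ∈ C''.diagram.chords.erase C''.basePt,
      factor s (C''.decAt y) (C''.nuAt y + if C''.tree.owner k = y then 1 else 0) := by
  rw [DecDiagram.weightHat_eq, DecDiagram.weight_eq, h.basePt_eq, h.chords_eq, h.erase_r,
    Finset.prod_union (h.disjoint_map _ _), Finset.prod_map, Finset.prod_map]
  congr 1
  · refine Finset.prod_congr rfl fun x hx => ?_
    rw [RelEmbedding.coe_toEmbedding, h.dec_left, h.nuAt_l hx]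
  · refine Finset.prod_congr rfl fun x hx => ?_
    rw [RelEmbedding.coe_toEmbedding, h.dec_right, h.nuAt_r (Finset.mem_of_mem_erase hx)]

end Coefficients

end Decomp
end DecDiagram

/-! ### The algebraic recursion and its solution -/

/-- The two parameter recursion behind the base chord expansion, for an operator `L` which obeys the
Leibniz rule. -/
theorem leibniz_recursion {𝒜 : Type*} [CommRing 𝒜] (L : 𝒜 →+ 𝒜)
    (hL : ∀ f g, L (f * g) = L f * g + f * L g) (c : 𝒜) (A : ℕ → 𝒜) (F : ℕ → ℕ → 𝒜)
    (hA : ∀ l, 1 ≤ l → A (l + 1) = A 1 * (L (A l) - A l))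
    (hF : ∀ j n, 1 ≤ j →
      F (j + 1) n = A 1 * (L (F j n) - c * F j n - n * F j n + n * F j (n - 1)))
    (hF0 : L (F 1 0) = c * F 1 0) (hF1 : ∀ n, F 1 (n + 1) = 0) (j : ℕ) :
    F (j + 2) 0 = 0 ∧ ∀ n, F (j + 1) (n + 1) =
      ∑ l ∈ Finset.range j, (j.choose (l + 1) : 𝒜) * A (l + 1) * F (j - l) n := by
  induction j with
  | zero =>
    refine ⟨?_, fun n => by simp [hF1]⟩
    rw [zero_add, hF 1 0 le_rfl, hF0]
    simp
  | succ j ih =>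
    refine ⟨?_, fun n => ?_⟩
    · rw [hF (j + 2) 0 (by omega), ih.1]
      simp
    · have hn : (n : 𝒜) * F (j + 1) n = ∑ l ∈ Finset.range j,
          (j.choose (l + 1) : 𝒜) * A (l + 1) * (n * F (j - l) (n - 1)) := by
        cases n with
        | zero => simp
        | succ m =>
          rw [ih.2, Finset.mul_sum]
          refine Finset.sum_congr rfl fun l _ => ?_
          rw [Nat.add_sub_cancel]
          ring
      have hLs : L (F (j + 1) (n + 1)) = ∑ l ∈ Finset.range j, (j.choose (l + 1) : 𝒜) *
          (L (A (l + 1)) * F (j - l) n + A (l + 1) * L (F (j - l) n)) := by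
        rw [ih.2, map_sum]
        refine Finset.sum_congr rfl fun l _ => ?_
        rw [mul_assoc, ← nsmul_eq_mul, map_nsmul, hL, nsmul_eq_mul]
      -- After the Leibniz rule, `A 1 * L` is eliminated by the two recursions; the terms in `c` and
      -- `n` cancel against those of the recursion for `F (j + 2) (n + 1)`.
      have h1 : F (j + 2) (n + 1) = A 1 * F (j + 1) n + ∑ l ∈ Finset.range j,
          (j.choose (l + 1) : 𝒜) * (A (l + 2) * F (j - l) n + A (l + 1) * F (j - l + 1) n) := by
        have : A 1 * (L (F (j + 1) (n + 1)) - c * F (j + 1) (n + 1)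
            - ((n : 𝒜) + 1) * F (j + 1) (n + 1) + n * F (j + 1) n) =
            ∑ l ∈ Finset.range j, (j.choose (l + 1) : 𝒜) *
              (A (l + 2) * F (j - l) n + A (l + 1) * F (j - l + 1) n) := by
          rw [hLs, hn, ih.2]
          simp only [Finset.mul_sum, ← Finset.sum_sub_distrib, ← Finset.sum_add_distrib]
          refine Finset.sum_congr rfl fun l hl => ?_
          rw [hA (l + 1) (by omega), hF (j - l) n (by have := Finset.mem_range.1 hl; omega)]
          ring
        rw [hF (j + 1) (n + 1) (by omega), Nat.add_sub_cancel, ← this]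
        push_cast
        ring
      rw [h1]
      -- Pascal's rule; the isolated term `A 1 * F (j + 1) n` is its boundary case.
      have h2 : ∀ l, ((j + 1).choose (l + 1) : 𝒜) * A (l + 1) * F (j + 1 - l) n =
          (j.choose l : 𝒜) * A (l + 1) * F (j + 1 - l) n +
            (j.choose (l + 1) : 𝒜) * A (l + 1) * F (j + 1 - l) n := by
        intro l
        rw [Nat.choose_succ_succ]
        push_cast
        ring
      simp only [h2, Finset.sum_add_distrib, mul_add]
      rw [Finset.sum_range_succ', Finset.sum_range_succ (fun l =>
        (j.choose (l + 1) : 𝒜) * A (l + 1) * F (j + 1 - l) n), Nat.choose_succ_self]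
      have h3 : ∀ l ∈ Finset.range j, (j.choose (l + 1) : 𝒜) * (A (l + 1) * F (j - l + 1) n) =
          (j.choose (l + 1) : 𝒜) * A (l + 1) * F (j + 1 - l) n := by
        intro l hl
        rw [show j + 1 - l = j - l + 1 by have := Finset.mem_range.1 hl; omega]
        ring
      rw [Finset.sum_congr rfl h3]
      simp only [Nat.add_sub_add_right, mul_assoc]
      simp
      ring

/-! ### Generating functions and their recursions -/

namespace DecDiagram

variable {Δ : Set ℕ+} {R : Type*} [CommRing R]

variable (Δ) in
/-- The generating function of decorated diagrams by the sum of the decorations. -/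
noncomputable def genFun (Φ : DecDiagram Δ → R) : PowerSeries R :=
  PowerSeries.mk fun N => ∑ C ∈ ofNorm Δ N, Φ C

/-- The bijection `C ↔ (C', C'', k)` is additive on norms, so once the sum over the insertion place
splits as a product, so does the series. The index `k` stands for the insertion place `k + 1`. -/
theorem genFun_eq_mul {Φ Φ₁ Φ₂ : DecDiagram Δ → R} (h1 : ∀ C : DecDiagram Δ, C.size = 1 → Φ C = 0)
    (ψ : DecDiagram Δ → DecDiagram Δ → ℕ → R)
    (hψ : ∀ C C' C'' k, Decomp C C' C'' (k + 1) → Φ C = ψ C' C'' k)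
    (hsum : ∀ C' C'', ∑ k ∈ Finset.range (2 * C''.size - 1), ψ C' C'' k = Φ₁ C' * Φ₂ C'') :
    genFun Δ Φ = genFun Δ Φ₁ * genFun Δ Φ₂ := by
  classical
  ext N
  simp only [PowerSeries.coeff_mul, genFun, PowerSeries.coeff_mk, Finset.sum_mul_sum, ← hsum]
  have hd : ∀ C : DecDiagram Δ, ∃ t : DecDiagram Δ × DecDiagram Δ × ℕ,
      2 ≤ C.size → Nonempty (Decomp C t.1 t.2.1 (t.2.2 + 1)) := by
    intro C
    by_cases hC : 2 ≤ C.size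
    · obtain ⟨C', C'', k, ⟨h⟩⟩ := exists_decomp C hC
      have hk := h.splice.one_le
      obtain ⟨k, rfl⟩ := Nat.exists_eq_add_of_le' hk
      exact ⟨(C', C'', k), fun _ => ⟨h⟩⟩
    · exact ⟨(C, C, 0), fun h => absurd h hC⟩
  choose t ht using hd
  have hfilter : ∑ C ∈ ofNorm Δ N, Φ C = ∑ C ∈ ofNorm Δ N with 2 ≤ C.size, Φ C := by
    rw [Finset.sum_filter]
    refine Finset.sum_congr rfl fun C _ => ?_
    split_ifs with h
    · rfl
    · exact h1 C (by have := C.size_pos; omega)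
  let T : Finset ((_ : ℕ × ℕ) × (_ : DecDiagram Δ) × (_ : DecDiagram Δ) × ℕ) :=
    (Finset.HasAntidiagonal.antidiagonal N).sigma fun p => (ofNorm Δ p.1).sigma fun _ =>
      (ofNorm Δ p.2).sigma fun C'' => Finset.range (2 * C''.size - 1)
  have hT : ∑ x ∈ Finset.HasAntidiagonal.antidiagonal N, ∑ C' ∈ ofNorm Δ x.1, ∑ C'' ∈ ofNorm Δ x.2,
      ∑ k ∈ Finset.range (2 * C''.size - 1), ψ C' C'' k =
      ∑ q ∈ T, ψ q.2.1 q.2.2.1 q.2.2.2 := by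
    simp only [T, Finset.sum_sigma]
  rw [hfilter, hT]
  refine Finset.sum_bij
    (fun C _ => ⟨((t C).1.norm, (t C).2.1.norm), (t C).1, (t C).2.1, (t C).2.2⟩) ?_ ?_ ?_ ?_
  · intro C hC
    rw [Finset.mem_filter, mem_ofNorm] at hC
    obtain ⟨h⟩ := ht C hC.2
    have := h.splice.lt
    simp only [T, Finset.mem_sigma, Finset.HasAntidiagonal.mem_antidiagonal,
      mem_ofNorm, Finset.mem_range, true_and]
    exact ⟨h.norm_eq.symm.trans hC.1, by omega⟩
  · intro C hC B hB hCB
    obtain ⟨h⟩ := ht C (Finset.mem_filter.1 hC).2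
    obtain ⟨h'⟩ := ht B (Finset.mem_filter.1 hB).2
    simp only [Sigma.mk.injEq, heq_eq_eq] at hCB
    obtain ⟨-, e1, e2, e3⟩ := hCB
    rw [e1, e2, e3] at h
    exact h.eq_of_parts h'
  · rintro ⟨⟨p, q⟩, C', C'', k⟩ hm
    simp only [T, Finset.mem_sigma, Finset.HasAntidiagonal.mem_antidiagonal,
      mem_ofNorm, Finset.mem_range] at hm
    obtain ⟨hpq, rfl, rfl, hk⟩ := hm
    obtain ⟨C, ⟨h⟩⟩ := exists_comp C' C'' (k := k + 1) (by omega) (by omega)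
    have hs : 2 ≤ C.size := by
      have := h.size_eq
      have := C'.size_pos
      have := C''.size_pos
      omega
    obtain ⟨h'⟩ := ht C hs
    obtain ⟨e1, e2, e3⟩ := h'.parts_eq h
    refine ⟨C, Finset.mem_filter.2 ⟨(mem_ofNorm C N).2 (h.norm_eq.trans hpq), hs⟩, ?_⟩
    rw [e1, e2, Nat.succ_injective e3]
  · intro C hC
    obtain ⟨h⟩ := ht C (Finset.mem_filter.1 hC).2
    exact hψ _ _ _ _ h

/-- The operator `s X d/dX`. -/
noncomputable def scaledEuler (s : R) : PowerSeries R →+ PowerSeries R where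
  toFun f := PowerSeries.mk fun N => s * N * PowerSeries.coeff N f
  map_zero' := by ext N; simp
  map_add' f g := by ext N; simp [mul_add]

theorem coeff_scaledEuler (s : R) (f : PowerSeries R) (N : ℕ) :
    PowerSeries.coeff N (scaledEuler s f) = s * N * PowerSeries.coeff N f := by
  simp [scaledEuler]

theorem scaledEuler_mul (s : R) (f g : PowerSeries R) :
    scaledEuler s (f * g) = scaledEuler s f * g + f * scaledEuler s g := by
  ext N
  rw [coeff_scaledEuler, map_add, PowerSeries.coeff_mul, PowerSeries.coeff_mul,
    PowerSeries.coeff_mul, Finset.mul_sum, ← Finset.sum_add_distrib]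
  refine Finset.sum_congr rfl fun p hp => ?_
  rw [coeff_scaledEuler, coeff_scaledEuler, ← Finset.HasAntidiagonal.mem_antidiagonal.1 hp]
  push_cast
  ring

theorem coeff_genFun (Φ : DecDiagram Δ → R) (N : ℕ) :
    PowerSeries.coeff N (genFun Δ Φ) = ∑ C ∈ ofNorm Δ N, Φ C := PowerSeries.coeff_mk _ _

theorem scaledEuler_genFun (s : R) (Φ : DecDiagram Δ → R) :
    scaledEuler s (genFun Δ Φ) = genFun Δ fun C => s * C.norm * Φ C := by
  ext N
  rw [coeff_scaledEuler, coeff_genFun, coeff_genFun, Finset.mul_sum]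
  refine Finset.sum_congr rfl fun C hC => ?_
  rw [(mem_ofNorm C N).1 hC]

theorem genFun_add (Φ Φ' : DecDiagram Δ → R) :
    genFun Δ Φ + genFun Δ Φ' = genFun Δ fun C => Φ C + Φ' C := by
  ext N; simp [coeff_genFun, Finset.sum_add_distrib]

theorem genFun_sub (Φ Φ' : DecDiagram Δ → R) :
    genFun Δ Φ - genFun Δ Φ' = genFun Δ fun C => Φ C - Φ' C := by
  ext N; simp [coeff_genFun, Finset.sum_sub_distrib]

theorem C_mul_genFun (r : R) (Φ : DecDiagram Δ → R) :
    PowerSeries.C r * genFun Δ Φ = genFun Δ fun C => r * Φ C := by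
  ext N; simp [coeff_genFun, Finset.mul_sum]

open Classical in
theorem sum_owner (C : DecDiagram Δ) (f : Fin (2 * C.size) → R) :
    ∑ k ∈ Finset.range (2 * C.size - 1), f (C.tree.owner (k + 1)) =
      ∑ x ∈ C.diagram.chords, ((C.nuAt x : R) + 1) * f x := by
  rw [← C.numEdges_tree]
  exact PlaneTree.sum_owner C.nodup_leaves_tree (fun x => mem_leaves_tree.symm) f

/-- Counting all edges by owner gives `∑ (ν + 1) = 2|C| - 1`, so `∑ (ν - 1) = -1`. -/
theorem sum_nuAt (C : DecDiagram Δ) (s : R) :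
    ∑ x ∈ C.diagram.chords, (((C.decAt x : ℕ) : R) * s + C.nuAt x - 1) = s * C.norm - 1 := by
  have h := C.sum_owner (R := R) fun _ => 1
  have hs := C.size_pos
  simp only [Finset.sum_const, Finset.card_range, mul_one, nsmul_eq_mul,
    Finset.sum_add_distrib, C.diagram.card_chords] at h
  rw [Nat.cast_sub (by omega)] at h
  simp only [Finset.sum_sub_distrib, Finset.sum_add_distrib, ← Finset.sum_mul, Finset.sum_const,
    C.diagram.card_chords, nsmul_eq_mul, DecDiagram.norm_eq]
  push_cast at h ⊢
  linear_combination -h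

section Weights

variable [BinomialRing R]

open Classical in
theorem prod_factor_update {C : DecDiagram Δ} (s : R) {T : Finset (Fin (2 * C.size))}
    {x : Fin (2 * C.size)} (hx : x ∈ T) :
    ((C.nuAt x : R) + 1) *
      ∏ y ∈ T, factor s (C.decAt y) (C.nuAt y + if x = y then 1 else 0) =
      (((C.decAt x : ℕ) : R) * s + C.nuAt x - 1) *
        ∏ y ∈ T, factor s (C.decAt y) (C.nuAt y) := by
  rw [← Finset.mul_prod_erase _ _ hx, ← Finset.mul_prod_erase _ (fun y => factor s _ _) hx,
    if_pos rfl, ← mul_assoc, factor_succ, mul_assoc]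
  congr 2
  refine Finset.prod_congr rfl fun y hy => ?_
  rw [if_neg (Finset.mem_erase.1 hy).1.symm, add_zero]

open Classical in
theorem prod_factor_update_of_notMem {C : DecDiagram Δ} (s : R) {T : Finset (Fin (2 * C.size))}
    {x : Fin (2 * C.size)} (hx : x ∉ T) :
    ∏ y ∈ T, factor s (C.decAt y) (C.nuAt y + if x = y then 1 else 0) =
      ∏ y ∈ T, factor s (C.decAt y) (C.nuAt y) := by
  refine Finset.prod_congr rfl fun y hy => ?_
  rw [if_neg (by rintro rfl; exact hx hy), add_zero]

/-- The summand of the left factor of the convolution. -/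
noncomputable def leftTerm (s : R) (a : ℕ+ → ℕ → R) (l : ℕ) (C : DecDiagram Δ) : R :=
  if l ≤ C.b then C.weight s * C.aHat a * a (C.decAt C.basePt) (C.b - l) else 0

/-- The summand `ω_Ĉ â_C`, restricted to given values of `b`, `ν` and the decoration of the base
chord. -/
noncomputable def baseTerm (s : R) (a : ℕ+ → ℕ → R) (d : ℕ+) (j n : ℕ) (C : DecDiagram Δ) : R :=
  if C.b = j ∧ C.nuAt C.basePt = n ∧ C.decAt C.basePt = d then C.weightHat s * C.aHat a else 0

/-- Only the weight depends on the insertion place, and its sum over all places contributes `s‖C''‖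
- 1`. Single chords drop out because `b = 1 < l + 1`. -/
theorem genFun_leftTerm_succ (s : R) (a : ℕ+ → ℕ → R) {l : ℕ} (hl : 1 ≤ l) :
    genFun Δ (leftTerm s a (l + 1)) = genFun Δ (leftTerm s a 1) *
      (scaledEuler s (genFun Δ (leftTerm s a l)) - genFun Δ (leftTerm s a l)) := by
  classical
  rw [scaledEuler_genFun, genFun_sub]
  refine genFun_eq_mul (fun C hC => ?_) (fun C' C'' k => if l ≤ C''.b then (C'.weight s *
    ∏ y ∈ C''.diagram.chords,
      factor s (C''.decAt y) (C''.nuAt y + if C''.tree.owner (k + 1) = y then 1 else 0)) *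
    (C''.aHat a * (C'.aHat a * a (C'.decAt C'.basePt) (C'.b - 1))) *
    a (C''.decAt C''.basePt) (C''.b - l) else 0) (fun C C' C'' k h => ?_) (fun C' C'' => ?_)
  · rw [leftTerm, if_neg]
    rw [b_eq_one hC]
    omega
  · simp only [leftTerm, h.b_eq, h.weight_eq, h.aHat_eq, h.basePt_eq, h.dec_right,
      Nat.add_le_add_iff_right, Nat.add_sub_add_right]
  · have hw := C''.sum_owner fun x => ∏ y ∈ C''.diagram.chords,
      factor s (C''.decAt y) (C''.nuAt y + if x = y then 1 else 0)
    rw [Finset.sum_congr rfl fun x hx => prod_factor_update s hx, ← Finset.sum_mul,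
      sum_nuAt, ← DecDiagram.weight_eq] at hw
    simp only [leftTerm, C'.b_pos, if_true]
    split_ifs with hb
    · simp only [← Finset.sum_mul, ← Finset.mul_sum, hw]
      ring
    · simp

/-- Places not owned by the base chord leave its `ν = n` alone and contribute `(s‖C''‖ - 1) - (d s +
n - 1)`. Those it owns raise `ν` from `n - 1` to `n`; there are `n` of them, and `ω_Ĉ''` is
unaffected. -/
theorem genFun_baseTerm_succ (s : R) (a : ℕ+ → ℕ → R) (d : ℕ+) {j : ℕ} (n : ℕ) (hj : 1 ≤ j) :
    genFun Δ (baseTerm s a d (j + 1) n) = genFun Δ (leftTerm s a 1) *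
      (scaledEuler s (genFun Δ (baseTerm s a d j n)) -
        PowerSeries.C (((d : ℕ) : R) * s) * genFun Δ (baseTerm s a d j n) -
        n * genFun Δ (baseTerm s a d j n) + n * genFun Δ (baseTerm s a d j (n - 1))) := by
  classical
  rw [← map_natCast (PowerSeries.C (R := R)) n, scaledEuler_genFun, C_mul_genFun, C_mul_genFun,
    C_mul_genFun, genFun_sub, genFun_sub, genFun_add]
  refine genFun_eq_mul (fun C hC => ?_) (fun C' C'' k =>
    if C''.b = j ∧ (C''.nuAt C''.basePt + if C''.tree.owner (k + 1) = C''.basePt then 1 else 0) = n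
      ∧ C''.decAt C''.basePt = d then (C'.weight s *
    ∏ y ∈ C''.diagram.chords.erase C''.basePt,
      factor s (C''.decAt y) (C''.nuAt y + if C''.tree.owner (k + 1) = y then 1 else 0)) *
    (C''.aHat a * (C'.aHat a * a (C'.decAt C'.basePt) (C'.b - 1))) else 0)
    (fun C C' C'' k h => ?_) (fun C' C'' => ?_)
  · rw [baseTerm, if_neg]
    rw [b_eq_one hC]
    omega
  · simp only [baseTerm, h.b_eq, h.weightHat_eq, h.aHat_eq, h.basePt_eq, h.dec_right,
      h.nuAt_r C''.basePt_mem_chords, Nat.add_right_cancel_iff]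
  · simp only [leftTerm, C'.b_pos, if_true, baseTerm]
    by_cases hbd : C''.b = j ∧ C''.decAt C''.basePt = d
    swap
    · have h1 : ∀ p : Prop, ¬ (C''.b = j ∧ p ∧ C''.decAt C''.basePt = d) :=
        fun p h => hbd ⟨h.1, h.2.2⟩
      simp [h1]
    obtain ⟨hb, hd⟩ := hbd
    simp only [hb, hd, true_and, and_true]
    set B := C''.basePt with hB
    set S := C''.diagram.chords with hS
    have hBS : B ∈ S := C''.basePt_mem_chords
    have hw := C''.sum_owner fun x => if (C''.nuAt B + if x = B then 1 else 0) = n then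
      ∏ y ∈ S.erase B, factor s (C''.decAt y) (C''.nuAt y + if x = y then 1 else 0) else 0
    have hsum := C''.sum_nuAt s
    rw [← Finset.add_sum_erase _ _ hBS, hd] at hsum
    rw [← Finset.add_sum_erase _ _ hBS, prod_factor_update_of_notMem s (Finset.notMem_erase B S),
      ← DecDiagram.weightHat_eq, if_pos rfl] at hw
    have h2 : ∀ x ∈ S.erase B, ((C''.nuAt x : R) + 1) *
        (if (C''.nuAt B + if x = B then 1 else 0) = n then
          ∏ y ∈ S.erase B, factor s (C''.decAt y) (C''.nuAt y + if x = y then 1 else 0) else 0) =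
        (((C''.decAt x : ℕ) : R) * s + C''.nuAt x - 1) *
          if C''.nuAt B = n then C''.weightHat s else 0 := by
      intro x hx
      rw [if_neg (Finset.mem_erase.1 hx).1, add_zero]
      split_ifs
      · rw [prod_factor_update s hx, ← DecDiagram.weightHat_eq]
      · simp
    rw [Finset.sum_congr rfl h2, ← Finset.sum_mul] at hw
    have h3 : ∀ k, (if (C''.nuAt B + if C''.tree.owner (k + 1) = B then 1 else 0) = n then
        (C'.weight s * ∏ y ∈ S.erase B, factor s (C''.decAt y)
          (C''.nuAt y + if C''.tree.owner (k + 1) = y then 1 else 0)) *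
        (C''.aHat a * (C'.aHat a * a (C'.decAt C'.basePt) (C'.b - 1))) else 0) =
        (if (C''.nuAt B + if C''.tree.owner (k + 1) = B then 1 else 0) = n then
        ∏ y ∈ S.erase B, factor s (C''.decAt y)
          (C''.nuAt y + if C''.tree.owner (k + 1) = y then 1 else 0) else 0) *
        (C'.weight s * C''.aHat a * C'.aHat a * a (C'.decAt C'.basePt) (C'.b - 1)) := by
      intro k
      split_ifs <;> ring
    simp only [h3]
    rw [← Finset.sum_mul, hw]
    -- For `n = 0` the left condition fails and the right factor is zero, so truncated subtraction
    -- causes no error.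
    have h4 : ((C''.nuAt B : R) + 1) * (if C''.nuAt B + 1 = n then C''.weightHat s else 0) =
        n * if C''.nuAt B = n - 1 then C''.weightHat s else 0 := by
      rcases n with _ | n
      · simp
      · simp only [Nat.add_right_cancel_iff, Nat.add_sub_cancel]
        split_ifs with h
        · rw [h]; push_cast; ring
        · simp
    have h5 : ∀ m, (if C''.nuAt B = m then C''.weightHat s * C''.aHat a else 0) =
        (if C''.nuAt B = m then C''.weightHat s else 0) * C''.aHat a := by
      intro m; split_ifs <;> simp
    rw [h4, h5, h5]
    by_cases hn : C''.nuAt B = n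
    · rw [if_pos hn]
      rw [hn] at hsum
      linear_combination (C'.weight s * C''.aHat a * C'.aHat a *
        a (C'.decAt C'.basePt) (C'.b - 1) * C''.weightHat s) * hsum
    · rw [if_neg hn]
      ring

end Weights
end DecDiagram
-- Initial values and comparison of coefficients
namespace DecDiagram

variable {Δ : Set ℕ+}

theorem size_eq_one_of_b_eq_one {C : DecDiagram Δ} (h : C.b = 1) : C.size = 1 := by
  by_contra hs
  have := C.size_pos
  obtain ⟨C', C'', k, ⟨hd⟩⟩ := exists_decomp C (by omega)
  have := hd.b_eq
  have := C''.b_pos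
  omega

theorem norm_pos (C : DecDiagram Δ) : 0 < C.norm := C.size_pos.trans_le C.size_le_norm

theorem decAt_le_norm (C : DecDiagram Δ) : (C.decAt C.basePt : ℕ) ≤ C.norm := by
  rw [norm_eq]
  exact Finset.single_le_sum (f := fun x => (C.decAt x : ℕ)) (fun _ _ => Nat.zero_le _)
    C.basePt_mem_chords

theorem ofNorm_zero : ofNorm Δ 0 = ∅ := by
  ext C
  have := C.norm_pos
  simp only [mem_ofNorm, Finset.notMem_empty, iff_false]
  omega

variable {R : Type*} [CommRing R]

theorem coeff_genFun_mul (Φ Φ' : DecDiagram Δ → R) (i : ℕ) :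
    PowerSeries.coeff (i + 1) (genFun Δ Φ * genFun Δ Φ') = ∑ k ∈ Finset.Icc 1 i,
      (∑ C ∈ ofNorm Δ k, Φ C) * ∑ C ∈ ofNorm Δ (i - k + 1), Φ' C := by
  rw [PowerSeries.coeff_mul]
  simp only [coeff_genFun]
  rw [Finset.Nat.sum_antidiagonal_eq_sum_range_succ
    fun k m => (∑ C ∈ ofNorm Δ k, Φ C) * ∑ C ∈ ofNorm Δ m, Φ' C]
  symm
  refine Finset.sum_subset_zero_on_sdiff (fun k hk => ?_) (fun k hk => ?_) (fun k hk => ?_)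
  · rw [Finset.mem_Icc] at hk
    rw [Finset.mem_range]
    omega
  · rw [Finset.mem_sdiff, Finset.mem_range, Finset.mem_Icc] at hk
    rcases Nat.eq_zero_or_pos k with rfl | h
    · simp [ofNorm_zero]
    · obtain rfl : k = i + 1 := by omega
      simp [ofNorm_zero]
  · rw [Finset.mem_Icc] at hk
    rw [show i + 1 - k = i - k + 1 by omega]

variable [BinomialRing R]

theorem genFun_baseTerm_one_succ (s : R) (a : ℕ+ → ℕ → R) (d : ℕ+) (n : ℕ) :
    genFun Δ (baseTerm s a d 1 (n + 1)) = 0 := by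
  ext N
  rw [coeff_genFun, map_zero]
  refine Finset.sum_eq_zero fun C _ => if_neg ?_
  rintro ⟨hb, hn, -⟩
  rw [nuAt_eq_zero (size_eq_one_of_b_eq_one hb)] at hn
  omega

theorem scaledEuler_genFun_baseTerm_one_zero (s : R) (a : ℕ+ → ℕ → R) (d : ℕ+) :
    scaledEuler s (genFun Δ (baseTerm s a d 1 0)) =
      PowerSeries.C (((d : ℕ) : R) * s) * genFun Δ (baseTerm s a d 1 0) := by
  rw [scaledEuler_genFun, C_mul_genFun]
  congr 1
  funext C
  unfold baseTerm
  split_ifs with h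
  · have hs := size_eq_one_of_b_eq_one h.1
    rw [norm_eq, chords_eq_singleton hs, Finset.sum_singleton, ← basePt_eq_root hs, h.2.2]
    ring
  · simp

/-- The decoration of the base chord had to be fixed so that `d s` is a constant in the recursion.
It is at most `‖C‖ = N`, hence a finite sum over `d` removes the restriction. -/
theorem sum_baseTerm (s : R) (a : ℕ+ → ℕ → R) (j n : ℕ) {N M : ℕ} (hN : N ≤ M + 1) :
    ∑ d ∈ Finset.Icc 1 M.succPNat, ∑ C ∈ ofNorm Δ N, baseTerm s a d j n C =
      ∑ C ∈ ofNorm Δ N with C.b = j ∧ C.nu C.baseChord = n, C.weightHat s * C.aHat a := by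
  rw [Finset.sum_comm, Finset.sum_filter]
  refine Finset.sum_congr rfl fun C hC => ?_
  rw [mem_ofNorm] at hC
  have hd : C.decAt C.basePt ∈ Finset.Icc 1 M.succPNat := by
    rw [Finset.mem_Icc, ← PNat.coe_le_coe (C.decAt C.basePt), Nat.succPNat_coe]
    exact ⟨one_le, C.decAt_le_norm.trans (hC.trans_le hN)⟩
  rw [Finset.sum_eq_single_of_mem _ hd]
  · simp only [baseTerm, and_true]
    rfl
  · intro d _ hne
    exact if_neg fun h => hne h.2.2.symm

theorem sum_weightHat_base_eq_zero (s : R) (a : ℕ+ → ℕ → R) (N : ℕ) {j : ℕ} (hj : 1 ≤ j) :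
    ∑ C ∈ ofNorm Δ N with C.b = j + 1 ∧ C.nu C.baseChord = 0, C.weightHat s * C.aHat a = 0 := by
  obtain ⟨j, rfl⟩ := Nat.exists_eq_add_of_le' hj
  rw [← sum_baseTerm s a (j + 1 + 1) 0 (Nat.le_succ N)]
  refine Finset.sum_eq_zero fun d _ => ?_
  rw [← coeff_genFun, (leibniz_recursion (scaledEuler s) (scaledEuler_mul s)
    (PowerSeries.C (((d : ℕ) : R) * s)) (fun l => genFun Δ (leftTerm s a l))
    (fun j n => genFun Δ (baseTerm s a d j n)) (fun l hl => genFun_leftTerm_succ s a hl)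
    (fun j n hj => genFun_baseTerm_succ s a d n hj) (scaledEuler_genFun_baseTerm_one_zero s a d)
    (fun n => genFun_baseTerm_one_succ s a d n) j).1, map_zero]

theorem sum_weightHat_base_succ (s : R) (a : ℕ+ → ℕ → R) (i j n : ℕ) :
    ∑ C ∈ ofNorm Δ (i + 1) with C.b = j + 1 ∧ C.nu C.baseChord = n + 1,
        C.weightHat s * C.aHat a =
      ∑ k ∈ Finset.Icc 1 i, ∑ l ∈ Finset.Icc 1 j, (j.choose l : R) *
        (∑ D₁ ∈ ofNorm Δ k with l ≤ D₁.b,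
          D₁.weight s * D₁.aHat a * a (D₁.d D₁.baseChord) (D₁.b - l)) *
        (∑ D₂ ∈ ofNorm Δ (i - k + 1) with D₂.b = j - l + 1 ∧ D₂.nu D₂.baseChord = n,
          D₂.weightHat s * D₂.aHat a) := by
  rw [← sum_baseTerm s a (j + 1) (n + 1) le_rfl]
  have hd : ∀ d : ℕ+, ∑ C ∈ ofNorm Δ (i + 1), baseTerm s a d (j + 1) (n + 1) C =
      ∑ k ∈ Finset.Icc 1 i, ∑ l ∈ Finset.range j, (j.choose (l + 1) : R) *
        (∑ D₁ ∈ ofNorm Δ k, leftTerm s a (l + 1) D₁) *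
        ∑ D₂ ∈ ofNorm Δ (i - k + 1), baseTerm s a d (j - l) n D₂ := by
    intro d
    rw [← coeff_genFun, (leibniz_recursion (scaledEuler s) (scaledEuler_mul s)
      (PowerSeries.C (((d : ℕ) : R) * s)) (fun l => genFun Δ (leftTerm s a l))
      (fun j n => genFun Δ (baseTerm s a d j n)) (fun l hl => genFun_leftTerm_succ s a hl)
      (fun j n hj => genFun_baseTerm_succ s a d n hj) (scaledEuler_genFun_baseTerm_one_zero s a d)
      (fun n => genFun_baseTerm_one_succ s a d n) j).2 n, map_sum, Finset.sum_comm]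
    refine Finset.sum_congr rfl fun l _ => ?_
    rw [mul_assoc, ← map_natCast (PowerSeries.C (R := R)), PowerSeries.coeff_C_mul,
      coeff_genFun_mul, Finset.mul_sum]
    exact Finset.sum_congr rfl fun k _ => (mul_assoc _ _ _).symm
  simp only [hd]
  rw [Finset.sum_comm]
  refine Finset.sum_congr rfl fun k hk => ?_
  rw [Finset.mem_Icc] at hk
  rw [Finset.sum_comm]
  refine Finset.sum_nbij' (· + 1) (· - 1) (by simp) (by simp; omega) (by simp) (by simp; omega)
    fun l hl => ?_
  rw [Finset.mem_range] at hl
  rw [← Finset.mul_sum, sum_baseTerm s a _ n (by omega), show j - (l + 1) + 1 = j - l by omega,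
    Finset.sum_filter (fun D₁ : DecDiagram Δ => l + 1 ≤ D₁.b)]
  congr 2
  refine Finset.sum_congr rfl fun C _ => ?_
  rw [leftTerm, ← decAt_coe]
  rfl

end DecDiagram
end ChordDiag
-- The two convolution identities
open ChordDiag in
theorem mainTheorem4 {R : Type*} [CommRing R] [BinomialRing R] (Δ : Set ℕ+)
    (s : R) (a : ℕ+ → ℕ → R) (i j : ℕ) :
    (0 < j →
      ∑ C ∈ DecDiagram.ofNorm Δ (i + 1) with C.b = j + 1, C.weightHat s * C.aHat a =
        ∑ k ∈ Finset.Icc 1 i, ∑ l ∈ Finset.Icc 1 j, (j.choose l : R) *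
          (∑ D₁ ∈ DecDiagram.ofNorm Δ k with l ≤ D₁.b,
            D₁.weight s * D₁.aHat a * a (D₁.d D₁.baseChord) (D₁.b - l)) *
          (∑ D₂ ∈ DecDiagram.ofNorm Δ (i - k + 1) with D₂.b = j - l + 1,
            D₂.weightHat s * D₂.aHat a)) ∧
    (∀ n : ℕ, 0 < j ∨ 0 < n →
      ∑ C ∈ DecDiagram.ofNorm Δ (i + 1) with C.b = j + 1 ∧ C.nu C.baseChord = n,
          C.weightHat s * C.aHat a =
        ∑ k ∈ Finset.Icc 1 i, ∑ l ∈ Finset.Icc 1 j, (j.choose l : R) *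
          (∑ D₁ ∈ DecDiagram.ofNorm Δ k with l ≤ D₁.b,
            D₁.weight s * D₁.aHat a * a (D₁.d D₁.baseChord) (D₁.b - l)) *
          (∑ D₂ ∈ DecDiagram.ofNorm Δ (i - k + 1) with
              D₂.b = j - l + 1 ∧ (D₂.nu D₂.baseChord : ℤ) = (n : ℤ) - 1,
            D₂.weightHat s * D₂.aHat a)) := by
  constructor
  · intro hj
    -- A common bound for `ν` of the base chord over all diagrams of norm at most `i + 1`, making
    -- the sum over its values finite.
    let M := ∑ N ∈ Finset.range (i + 2), ∑ C ∈ DecDiagram.ofNorm Δ N, C.nu C.baseChord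
    have hM : ∀ N ≤ i + 1, ∀ C ∈ DecDiagram.ofNorm Δ N, C.nu C.baseChord < M + 1 := by
      intro N hN C hC
      refine Nat.lt_succ_of_le ((Finset.single_le_sum (f := fun C : DecDiagram Δ =>
        C.nu C.baseChord) (fun _ _ => Nat.zero_le _) hC).trans ?_)
      exact Finset.single_le_sum (f := fun N => ∑ C ∈ DecDiagram.ofNorm Δ N, C.nu C.baseChord)
        (fun _ _ => Nat.zero_le _) (Finset.mem_range.2 (Nat.lt_succ_of_le hN))
    have hfib : ∀ m N, m ≥ M + 1 → N ≤ i + 1 → ∀ b : ℕ, ∑ C ∈ DecDiagram.ofNorm Δ N with C.b = b,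
        C.weightHat s * C.aHat a = ∑ n ∈ Finset.range m,
          ∑ C ∈ DecDiagram.ofNorm Δ N with C.b = b ∧ C.nu C.baseChord = n,
            C.weightHat s * C.aHat a := by
      intro m N hm hN b
      rw [← Finset.sum_fiberwise_of_maps_to (g := fun C : DecDiagram Δ => C.nu C.baseChord)
        (t := Finset.range m)]
      · simp only [Finset.filter_filter]
      · intro C hC
        exact Finset.mem_range.2 ((hM N hN C (Finset.mem_filter.1 hC).1).trans_le hm)
    -- One value more than on the right: the value `0` contributes nothing, and the remaining values
    -- `n + 1` correspond to `n < M + 1`.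
    rw [hfib (M + 1 + 1) _ (Nat.le_succ _) le_rfl, Finset.sum_range_succ',
      DecDiagram.sum_weightHat_base_eq_zero s a _ hj, add_zero]
    simp only [DecDiagram.sum_weightHat_base_succ]
    rw [Finset.sum_comm]
    refine Finset.sum_congr rfl fun k hk => ?_
    rw [Finset.mem_Icc] at hk
    rw [Finset.sum_comm]
    refine Finset.sum_congr rfl fun l _ => ?_
    rw [← Finset.mul_sum, ← hfib (M + 1) _ le_rfl (by omega)]
  · intro n hjn
    rcases n with _ | n
    · rw [DecDiagram.sum_weightHat_base_eq_zero s a _ (by omega)]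
      symm
      refine Finset.sum_eq_zero fun k _ => Finset.sum_eq_zero fun l _ => ?_
      refine mul_eq_zero_of_right _ (Finset.sum_eq_zero fun D hD => ?_)
      -- For `n = 0` the condition is `ν = -1` in `ℤ`, so the inner sum is empty.
      have h := (Finset.mem_filter.1 hD).2.2
      push_cast at h
    · rw [DecDiagram.sum_weightHat_base_succ]
      push_cast
      simp only [add_sub_cancel_right, Nat.cast_inj]
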